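/- Let $F$ be R. Thompson's group, i.e. the group of all piecewise linear increasing self-homeomorphisms of $[0,1]$ with finitely many break points, all of them in $\mathbb{Z}[\frac12]$, and with all slopes integer powers of $2$. Let $U\subset(0,1)$ be a finite set and let $H_U=\{f\in F : f(u)=u \text{ for all } u\in U\}$ be its stabilizer. Then $H_U$ is finitely generated if and only if $U$ consists of rational numbers. Moreover, if $U$ consists of rational numbers, $U_1=U\cap\mathbb{Z}[\frac12]$ and $U_2=U\setminus U_1$, then the smallest number of generators of $H_U$ is $2|U_1|+|U_2|+2$. -/

import Mathlib

open scoped unitInterval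

/-- Membership in `ℤ[1/2]`: finite binary fractions. -/
def IsDyadicReal (x : ℝ) : Prop := ∃ (m : ℤ) (n : ℕ), x = (m : ℝ) / 2 ^ n

namespace IsDyadicReal

theorem add {x y : ℝ} (hx : IsDyadicReal x) (hy : IsDyadicReal y) : IsDyadicReal (x + y) := by
  obtain ⟨m, n, rfl⟩ := hx
  obtain ⟨m', n', rfl⟩ := hy
  refine ⟨m * 2 ^ n' + m' * 2 ^ n, n + n', ?_⟩
  push_cast
  field_simp
  ring

theorem neg {x : ℝ} (hx : IsDyadicReal x) : IsDyadicReal (-x) := by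
  obtain ⟨m, n, rfl⟩ := hx
  exact ⟨-m, n, by push_cast; ring⟩

theorem sub {x y : ℝ} (hx : IsDyadicReal x) (hy : IsDyadicReal y) : IsDyadicReal (x - y) := by
  rw [sub_eq_add_neg]
  exact hx.add hy.neg

theorem zero : IsDyadicReal 0 := ⟨0, 0, by simp⟩

theorem zpow_mul {x : ℝ} (k : ℤ) (hx : IsDyadicReal x) : IsDyadicReal ((2 : ℝ) ^ k * x) := by
  obtain ⟨m, n, rfl⟩ := hx
  obtain ⟨j, rfl | rfl⟩ := k.eq_nat_or_neg
  · exact ⟨2 ^ j * m, n, by push_cast; rw [zpow_natCast]; ring⟩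
  · refine ⟨m, j + n, ?_⟩
    rw [zpow_neg, zpow_natCast, pow_add]
    field_simp

end IsDyadicReal

/-- An order automorphism of `[0,1]` (equivalently, an increasing self-homeomorphism of `[0,1]`)
belongs to Thompson's group `F` if it is piecewise linear with finitely many break points, all of
them in `ℤ[1/2]`, and the slopes of all linear pieces are integer powers of `2`. Here `B` contains
all the break points, so the map is affine on every interval whose interior avoids `B`. -/
def IsThompson (f : I ≃o I) : Prop :=
  ∃ B : Finset I, (∀ b ∈ B, IsDyadicReal (b : ℝ)) ∧
    ∀ a b : I, a < b → (∀ x ∈ B, x ∉ Set.Ioo a b) →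
      ∃ (k : ℤ) (c : ℝ), ∀ x ∈ Set.Icc a b, ((f x : I) : ℝ) = 2 ^ k * (x : ℝ) + c

namespace IsThompson

/-- For every positive point `d`, some dyadic point `m < d` (which is `0` or a break point) is
joined to `d` by a linear piece. -/
theorem exists_left {f : I ≃o I} {B : Finset I} (hB : ∀ b ∈ B, IsDyadicReal (b : ℝ))
    (h : ∀ a b : I, a < b → (∀ x ∈ B, x ∉ Set.Ioo a b) →
      ∃ (k : ℤ) (c : ℝ), ∀ x ∈ Set.Icc a b, ((f x : I) : ℝ) = 2 ^ k * (x : ℝ) + c)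
    (d : I) (hd : 0 < d) :
    ∃ m : I, m < d ∧ (m = 0 ∨ m ∈ B) ∧ IsDyadicReal (m : ℝ) ∧
      ∃ k : ℤ, ((f d : I) : ℝ) = (f m : I) + 2 ^ k * ((d : ℝ) - m) := by
  classical
  set S : Finset I := insert 0 (B.filter (fun x => x < d)) with hS
  have hne : S.Nonempty := ⟨0, by simp [hS]⟩
  have hm := S.max'_mem hne
  set m := S.max' hne with hmdef
  have hmS : m = 0 ∨ (m ∈ B ∧ m < d) := by simpa [hS] using hm
  have hmd : m < d := by
    rcases hmS with h0 | h0
    · rw [h0]; exact hd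
    · exact h0.2
  have hgap : ∀ x ∈ B, x ∉ Set.Ioo m d := by
    intro x hx hxm
    have : x ≤ m := S.le_max' x (by simp [hS, hx, hxm.2])
    exact absurd hxm.1 (not_lt.mpr this)
  obtain ⟨k, c, hk⟩ := h m d hmd hgap
  refine ⟨m, hmd, hmS.imp_right And.left, ?_, k, ?_⟩
  · rcases hmS with h0 | h0
    · rw [h0]; exact IsDyadicReal.zero
    · exact hB m h0.1
  · rw [hk m ⟨le_rfl, hmd.le⟩, hk d ⟨hmd.le, le_rfl⟩]
    ring

theorem dyadic_apply {f : I ≃o I} (hf : IsThompson f) (d : I) (hd : IsDyadicReal (d : ℝ)) :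
    IsDyadicReal ((f d : I) : ℝ) := by
  classical
  obtain ⟨B, hB, h⟩ := hf
  have key : ∀ (n : ℕ) (d : I), (B.filter (fun x => x < d)).card = n →
      IsDyadicReal (d : ℝ) → IsDyadicReal ((f d : I) : ℝ) := by
    intro n
    induction n using Nat.strong_induction_on with
    | _ n ih =>
      intro d hn hd
      rcases (bot_le : (⊥ : I) ≤ d).eq_or_lt with h0 | h0
      · rw [← h0, f.map_bot]; exact IsDyadicReal.zero
      · obtain ⟨m, hmd, hm, hdy, k, hk⟩ := exists_left hB h d h0
        have hfm : IsDyadicReal ((f m : I) : ℝ) := by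
          rcases hm with rfl | hm
          · have : f 0 = 0 := f.map_bot
            rw [this]; exact IsDyadicReal.zero
          · refine ih _ ?_ m rfl hdy
            rw [← hn]
            refine Finset.card_lt_card ⟨fun x hx => ?_, fun hsub => ?_⟩
            · rw [Finset.mem_filter] at hx ⊢
              exact ⟨hx.1, hx.2.trans hmd⟩
            · have := hsub (Finset.mem_filter.mpr ⟨hm, hmd⟩)
              exact lt_irrefl _ (Finset.mem_filter.mp this).2
        rw [hk]
        exact hfm.add ((hd.sub hdy).zpow_mul k)
  exact key _ d rfl hd

theorem dyadic_of_apply {f : I ≃o I} (hf : IsThompson f) (d : I)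
    (hd : IsDyadicReal ((f d : I) : ℝ)) : IsDyadicReal (d : ℝ) := by
  have hf' := hf
  obtain ⟨B, hB, h⟩ := hf
  rcases (bot_le : (⊥ : I) ≤ d).eq_or_lt with h0 | h0
  · rw [← h0]; exact IsDyadicReal.zero
  · obtain ⟨m, -, -, hdy, k, hk⟩ := exists_left hB h d h0
    have hfm := hf'.dyadic_apply m hdy
    have e : (d : ℝ) = m + 2 ^ (-k) * (((f d : I) : ℝ) - (f m : I)) := by
      rw [hk, zpow_neg]
      field_simp
      ring
    rw [e]
    exact hdy.add ((hd.sub hfm).zpow_mul _)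

theorem one : IsThompson 1 :=
  ⟨∅, by simp, fun a b _ _ => ⟨0, 0, fun x _ => by simp⟩⟩

theorem mul {f g : I ≃o I} (hf : IsThompson f) (hg : IsThompson g) : IsThompson (f * g) := by
  classical
  have hg' := hg
  obtain ⟨B, hB, h⟩ := hf
  obtain ⟨C, hC, h'⟩ := hg
  refine ⟨C ∪ B.image g.symm, ?_, ?_⟩
  · intro b hb
    rcases Finset.mem_union.mp hb with hb | hb
    · exact hC b hb
    · obtain ⟨y, hy, rfl⟩ := Finset.mem_image.mp hb
      exact hg'.dyadic_of_apply _ (by simpa using hB y hy)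
  · intro a b hab hgap
    obtain ⟨k, c, hk⟩ := h' a b hab fun x hx => hgap x (Finset.mem_union_left _ hx)
    obtain ⟨l, e, hl⟩ := h (g a) (g b) (g.strictMono hab) fun y hy hyab =>
      hgap (g.symm y) (Finset.mem_union_right _ (Finset.mem_image_of_mem _ hy))
        ⟨(g.lt_symm_apply).mpr hyab.1, (g.symm_apply_lt).mpr hyab.2⟩
    refine ⟨l + k, 2 ^ l * c + e, fun x hx => ?_⟩
    have := hl (g x) ⟨g.monotone hx.1, g.monotone hx.2⟩
    rw [RelIso.mul_apply, this, hk x hx, zpow_add₀ two_ne_zero]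
    ring

theorem inv {f : I ≃o I} (hf : IsThompson f) : IsThompson f⁻¹ := by
  classical
  have hf' := hf
  obtain ⟨B, hB, h⟩ := hf
  refine ⟨B.image f, ?_, ?_⟩
  · intro b hb
    obtain ⟨y, hy, rfl⟩ := Finset.mem_image.mp hb
    exact hf'.dyadic_apply y (hB y hy)
  · intro a b hab hgap
    obtain ⟨k, c, hk⟩ := h (f.symm a) (f.symm b) (f.symm.strictMono hab) fun x hx hxab =>
      hgap (f x) (Finset.mem_image_of_mem _ hx)
        ⟨(f.symm_apply_lt).mp hxab.1, (f.lt_symm_apply).mp hxab.2⟩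
    refine ⟨-k, -(2 ^ (-k) * c), fun y hy => ?_⟩
    have := hk (f.symm y) ⟨f.symm.monotone hy.1, f.symm.monotone hy.2⟩
    rw [OrderIso.apply_symm_apply] at this
    change ((f.symm y : I) : ℝ) = _
    rw [this, zpow_neg]
    field_simp
    ring

end IsThompson

/-- R. Thompson's group `F`. -/
def thompsonF : Subgroup (I ≃o I) where
  carrier := {f | IsThompson f}
  mul_mem' := IsThompson.mul
  one_mem' := IsThompson.one
  inv_mem' := IsThompson.inv

/-- The stabilizer `H_U` in `F` of a set `U` of real numbers: the elements of `F` that fix every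
point of `U` (for finite `U` and increasing maps it is the same to preserve `U` as a set). -/
def thompsonStabilizer (U : Set ℝ) : Subgroup thompsonF where
  carrier := {f | ∀ x : I, (x : ℝ) ∈ U → (f : I ≃o I) x = x}
  mul_mem' := by
    intro f g hf hg x hx
    change (f : I ≃o I) ((g : I ≃o I) x) = x
    rw [hg x hx, hf x hx]
  one_mem' := fun x _ => rfl
  inv_mem' := by
    intro f hf x hx
    change (f : I ≃o I).symm x = x
    rw [OrderIso.symm_apply_eq, hf x hx]

/-- The part `U₁` of the natural partition: the elements of `U` in `ℤ[1/2]`. -/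
def dyadicPart (U : Set ℝ) : Set ℝ := {x ∈ U | IsDyadicReal x}

/-- The part `U₂` of the natural partition: the rational elements of `U` not in `ℤ[1/2]`. -/
def nonDyadicRationalPart (U : Set ℝ) : Set ℝ :=
  {x ∈ U | x ∈ Set.range ((↑) : ℚ → ℝ) ∧ ¬ IsDyadicReal x}

/-! Extending maps by the identity turns `H_U` into a group of dyadic piecewise linear
homeomorphisms of the whole line (`stabilizerEquiv`), where conjugation and gluing are easy.
Everything depends on germs at the fixed points. An affine germ `y ↦ 2 ^ k * y + c` with `c` dyadic
fixes `u` only if `c = (1 - 2 ^ k) * u`.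

If `u` is irrational this forces `k = 0`, so every element of `H_U` is the identity near `u`.
Finitely many generators are then the identity on a common neighbourhood to the right of `u`, and so
is the group they generate; a small bump there gives a contradiction (`not_fg_of_irrational`).

If `u` is rational, the possible germs on one side of `u` form an infinite cyclic group, generated
by a contraction. At a dyadic `u` the left and right germs are independent; at a non-dyadic `u` no
break is allowed, so they coincide. With the left germ at `1` and the right germ at `0` this makes
`2|U₁| + |U₂| + 2` independent integer invariants, the logarithms of slopes. They bound the number
of generators from below (`Group.card_le_card_of_closure_eq_top`).

For the upper bound, order the points as `0 = w 0 < ... < w (n + 1) = 1`. A chart (`nonempty_chart`)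
carries the line onto `(w i, w (i + 1))` and turns unit translations near `±∞` into the contractions
of the end points. The maps `shift` and `stretch`, which are the classical two generators of `F`
acting on the line, generate all compactly supported maps (`mem_closure_of_support`). Transported by
the chart they yield `leftGen` and `rightGen`, each realising one germ. At a non-dyadic point the
two adjacent maps are multiplied into one generator. These products still generate
(`stabGen_closure_eq`): germs are cancelled one point at a time, and what remains has compact
support inside the open intervals. -/

open Filter Topology

/-! ### Dyadic numbers: invariance under affine maps, and density. -/

namespace IsDyadicReal

theorem intCast (n : ℤ) : IsDyadicReal n := ⟨n, 0, by simp⟩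

theorem mul_two_zpow_iff {x : ℝ} (k : ℤ) : IsDyadicReal ((2 : ℝ) ^ k * x) ↔ IsDyadicReal x := by
  refine ⟨fun h => ?_, fun h => h.zpow_mul k⟩
  have := h.zpow_mul (-k)
  rwa [← mul_assoc, ← zpow_add₀ two_ne_zero, neg_add_cancel, zpow_zero, one_mul] at this

theorem affine_iff {x c : ℝ} (k : ℤ) (hc : IsDyadicReal c) :
    IsDyadicReal ((2 : ℝ) ^ k * x + c) ↔ IsDyadicReal x := by
  rw [← mul_two_zpow_iff k (x := x)]
  refine ⟨fun h => ?_, fun h => h.add hc⟩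
  simpa using h.sub hc

theorem exists_between {x y : ℝ} (h : x < y) : ∃ d, IsDyadicReal d ∧ x < d ∧ d < y := by
  obtain ⟨n, hn⟩ := pow_unbounded_of_one_lt (1 / (y - x)) (one_lt_two (α := ℝ))
  have h2 : (0 : ℝ) < 2 ^ n := by positivity
  rw [div_lt_iff₀ (sub_pos.2 h)] at hn
  refine ⟨(⌊x * 2 ^ n⌋ + 1 : ℤ) / 2 ^ n, ⟨_, n, rfl⟩, ?_, ?_⟩
  · rw [lt_div_iff₀ h2]
    push_cast
    exact Int.lt_floor_add_one _
  · rw [div_lt_iff₀ h2]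
    push_cast
    nlinarith [Int.floor_le (x * 2 ^ n)]

end IsDyadicReal

/-! ### Affine germs and the group of dyadic piecewise linear homeomorphisms of the line. -/

/-- Along the filter `l`, the function `f` is affine, with slope `2 ^ k` and dyadic constant
term `c`. -/
def IsAffGerm (l : Filter ℝ) (f : ℝ → ℝ) (k : ℤ) (c : ℝ) : Prop :=
  IsDyadicReal c ∧ ∀ᶠ y in l, f y = 2 ^ k * y + c

theorem tendsto_affine_Ici (k : ℤ) (c x : ℝ) :
    Tendsto (fun y : ℝ => 2 ^ k * y + c) (𝓝[≥] x) (𝓝[≥] (2 ^ k * x + c)) := by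
  refine tendsto_nhdsWithin_iff.2 ⟨(Continuous.tendsto (by fun_prop) x).mono_left
    nhdsWithin_le_nhds, ?_⟩
  filter_upwards [self_mem_nhdsWithin] with y hy
  have : (0 : ℝ) < 2 ^ k := by positivity
  simp only [Set.mem_Ici] at hy ⊢
  nlinarith

theorem tendsto_affine_Iic (k : ℤ) (c x : ℝ) :
    Tendsto (fun y : ℝ => 2 ^ k * y + c) (𝓝[≤] x) (𝓝[≤] (2 ^ k * x + c)) := by
  refine tendsto_nhdsWithin_iff.2 ⟨(Continuous.tendsto (by fun_prop) x).mono_left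
    nhdsWithin_le_nhds, ?_⟩
  filter_upwards [self_mem_nhdsWithin] with y hy
  have : (0 : ℝ) < 2 ^ k := by positivity
  simp only [Set.mem_Iic] at hy ⊢
  nlinarith

namespace IsAffGerm

variable {l l' : Filter ℝ} {f g : ℝ → ℝ} {k k' : ℤ} {c c' x : ℝ}

theorem congr (h : IsAffGerm l f k c) (hfg : ∀ᶠ y in l, g y = f y) : IsAffGerm l g k c :=
  ⟨h.1, by filter_upwards [h.2, hfg] with y h1 h2; rw [h2, h1]⟩

theorem apply_Ici (h : IsAffGerm (𝓝[≥] x) f k c) : f x = 2 ^ k * x + c :=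
  h.2.self_of_nhdsWithin (Set.mem_Ici.2 le_rfl)

theorem apply_Iic (h : IsAffGerm (𝓝[≤] x) f k c) : f x = 2 ^ k * x + c :=
  h.2.self_of_nhdsWithin (Set.mem_Iic.2 le_rfl)

theorem tendsto_Ici (h : IsAffGerm (𝓝[≥] x) f k c) : Tendsto f (𝓝[≥] x) (𝓝[≥] (f x)) := by
  rw [h.apply_Ici]
  exact (tendsto_affine_Ici k c x).congr' (h.2.mono fun y hy => hy.symm)

theorem tendsto_Iic (h : IsAffGerm (𝓝[≤] x) f k c) : Tendsto f (𝓝[≤] x) (𝓝[≤] (f x)) := by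
  rw [h.apply_Iic]
  exact (tendsto_affine_Iic k c x).congr' (h.2.mono fun y hy => hy.symm)

theorem comp (hg : IsAffGerm l' g k' c') (hf : IsAffGerm l f k c) (ht : Tendsto f l l') :
    IsAffGerm l (fun y => g (f y)) (k' + k) (2 ^ k' * c + c') := by
  refine ⟨(hf.1.zpow_mul k').add hg.1, ?_⟩
  filter_upwards [hf.2, ht.eventually hg.2] with y h1 h2
  rw [h2, h1, zpow_add₀ two_ne_zero]
  ring

theorem inverse (hf : IsAffGerm l f k c)
    (ht : Tendsto (fun y : ℝ => 2 ^ (-k) * y + -(2 ^ (-k) * c)) l' l)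
    (hgf : ∀ᶠ y in l, g (f y) = y) : IsAffGerm l' g (-k) (-(2 ^ (-k) * c)) := by
  refine ⟨(hf.1.zpow_mul _).neg, ?_⟩
  filter_upwards [ht.eventually hf.2, ht.eventually hgf] with y h1 h2
  have : (2 : ℝ) ^ k * (2 ^ (-k) * y + -(2 ^ (-k) * c)) + c = y := by
    rw [zpow_neg]; field_simp; ring
  rw [this] at h1
  rw [← h2, h1]

theorem inverse_Ici (hf : IsAffGerm (𝓝[≥] x) f k c) (hgf : ∀ᶠ y in 𝓝[≥] x, g (f y) = y) :
    IsAffGerm (𝓝[≥] (f x)) g (-k) (-(2 ^ (-k) * c)) := by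
  refine hf.inverse ?_ hgf
  have := tendsto_affine_Ici (-k) (-(2 ^ (-k) * c)) (f x)
  rw [show (2 : ℝ) ^ (-k) * f x + -(2 ^ (-k) * c) = x by
    rw [hf.apply_Ici, zpow_neg]; field_simp; ring] at this
  exact this

theorem inverse_Iic (hf : IsAffGerm (𝓝[≤] x) f k c) (hgf : ∀ᶠ y in 𝓝[≤] x, g (f y) = y) :
    IsAffGerm (𝓝[≤] (f x)) g (-k) (-(2 ^ (-k) * c)) := by
  refine hf.inverse ?_ hgf
  have := tendsto_affine_Iic (-k) (-(2 ^ (-k) * c)) (f x)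
  rw [show (2 : ℝ) ^ (-k) * f x + -(2 ^ (-k) * c) = x by
    rw [hf.apply_Iic, zpow_neg]; field_simp; ring] at this
  exact this

end IsAffGerm

/-- Affine maps with different slopes agree at one point only. A filter that tends to `x` while
avoiding `x` cannot concentrate on a single point. -/
theorem affine_eq_of_eventuallyEq {l : Filter ℝ} [NeBot l] {x : ℝ} (hl : l ≤ 𝓝[≠] x)
    {k k' : ℤ} {c c' : ℝ} (h : ∀ᶠ y in l, (2 : ℝ) ^ k * y + c = 2 ^ k' * y + c') :
    k = k' ∧ c = c' := by
  by_cases hk : k = k'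
  · subst hk
    obtain ⟨y, hy⟩ := h.exists
    exact ⟨rfl, by linarith⟩
  · exfalso
    have hne : (2 : ℝ) ^ k - 2 ^ k' ≠ 0 := by
      rw [sub_ne_zero]
      exact fun h => hk (zpow_right_injective₀ two_pos (by norm_num) h)
    set z := (c' - c) / ((2 : ℝ) ^ k - 2 ^ k') with hz
    have hyz : ∀ᶠ y in l, y = z := by
      filter_upwards [h] with y hy
      rw [hz, eq_div_iff hne]
      linarith
    have hx : ∀ᶠ y in l, y ≠ x := hl self_mem_nhdsWithin
    obtain ⟨y, hy, hyx⟩ := (hyz.and hx).exists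
    have hzx : z ≠ x := hy ▸ hyx
    have : ∀ᶠ y in l, y ≠ z :=
      (hl.trans nhdsWithin_le_nhds) (isOpen_ne.mem_nhds hzx.symm)
    obtain ⟨y, hy, hy'⟩ := (hyz.and this).exists
    exact hy' hy

theorem IsAffGerm.unique_Ici {f : ℝ → ℝ} {k k' : ℤ} {c c' x : ℝ} (h : IsAffGerm (𝓝[≥] x) f k c)
    (h' : IsAffGerm (𝓝[≥] x) f k' c') : k = k' ∧ c = c' := by
  have hl : 𝓝[>] x ≤ 𝓝[≥] x := nhdsWithin_mono _ Set.Ioi_subset_Ici_self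
  refine affine_eq_of_eventuallyEq (l := 𝓝[>] x) (x := x)
    (nhdsWithin_mono _ fun y (hy : x < y) => hy.ne') ?_
  filter_upwards [hl h.2, hl h'.2] with y h1 h2
  rw [← h1, ← h2]

theorem IsAffGerm.unique_Iic {f : ℝ → ℝ} {k k' : ℤ} {c c' x : ℝ} (h : IsAffGerm (𝓝[≤] x) f k c)
    (h' : IsAffGerm (𝓝[≤] x) f k' c') : k = k' ∧ c = c' := by
  have hl : 𝓝[<] x ≤ 𝓝[≤] x := nhdsWithin_mono _ Set.Iio_subset_Iic_self
  refine affine_eq_of_eventuallyEq (l := 𝓝[<] x) (x := x)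
    (nhdsWithin_mono _ fun y (hy : y < x) => hy.ne) ?_
  filter_upwards [hl h.2, hl h'.2] with y h1 h2
  rw [← h1, ← h2]

/-- Near `x`, the function `f` is dyadic piecewise linear, with `x` as the only possible break
point, and a break at `x` is allowed only if `x` is dyadic. -/
def DyadicPLAt (f : ℝ → ℝ) (x : ℝ) : Prop :=
  ∃ (k : ℤ) (c : ℝ) (k' : ℤ) (c' : ℝ), IsAffGerm (𝓝[≤] x) f k c ∧ IsAffGerm (𝓝[≥] x) f k' c' ∧
    (IsDyadicReal x ∨ k = k' ∧ c = c')

namespace DyadicPLAt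

variable {f g : ℝ → ℝ} {x : ℝ}

theorem of_germs {p q : ℝ → ℝ} (hp : DyadicPLAt p x) (hq : DyadicPLAt q x)
    (hfp : ∀ᶠ y in 𝓝[≤] x, f y = p y) (hfq : ∀ᶠ y in 𝓝[≥] x, f y = q y)
    (h : IsDyadicReal x ∨ p = q) : DyadicPLAt f x := by
  obtain ⟨k, c, k', c', h1, h2, h3⟩ := hp
  obtain ⟨l, d, l', d', h1', h2', h3'⟩ := hq
  refine ⟨k, c, l', d', h1.congr hfp, h2'.congr hfq, ?_⟩
  rcases h with h | rfl
  · exact Or.inl h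
  · rcases h3 with h3 | h3
    · exact Or.inl h3
    · obtain ⟨rfl, rfl⟩ := h2.unique_Ici h2'
      exact Or.inr h3

theorem congr (hf : DyadicPLAt f x) (h : ∀ᶠ y in 𝓝 x, g y = f y) : DyadicPLAt g x :=
  of_germs hf hf (nhdsWithin_le_nhds h) (nhdsWithin_le_nhds h) (Or.inr rfl)

theorem dyadic_iff (hf : DyadicPLAt f x) : IsDyadicReal (f x) ↔ IsDyadicReal x := by
  obtain ⟨k, c, k', c', h1, h2, h3⟩ := hf
  rw [h1.apply_Iic, IsDyadicReal.affine_iff k h1.1]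

theorem comp (hg : DyadicPLAt g (f x)) (hf : DyadicPLAt f x) :
    DyadicPLAt (fun y => g (f y)) x := by
  have hd := hf.dyadic_iff
  obtain ⟨k, c, k', c', h1, h2, h3⟩ := hf
  obtain ⟨l, d, l', d', h1', h2', h3'⟩ := hg
  refine ⟨_, _, _, _, h1'.comp h1 h1.tendsto_Iic, h2'.comp h2 h2.tendsto_Ici, ?_⟩
  -- A break of `g` matters at `f x`, and `f x` is dyadic exactly when `x` is.
  rw [hd] at h3'
  rcases h3 with h3 | ⟨rfl, rfl⟩
  · exact Or.inl h3
  · rcases h3' with h3' | ⟨rfl, rfl⟩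
    · exact Or.inl h3'
    · exact Or.inr ⟨rfl, rfl⟩

theorem inverse (hf : DyadicPLAt f x) (hgf : ∀ᶠ y in 𝓝 x, g (f y) = y) :
    DyadicPLAt g (f x) := by
  have hd := hf.dyadic_iff
  obtain ⟨k, c, k', c', h1, h2, h3⟩ := hf
  refine ⟨_, _, _, _, h1.inverse_Iic (nhdsWithin_le_nhds hgf),
    h2.inverse_Ici (nhdsWithin_le_nhds hgf), ?_⟩
  rw [hd]
  rcases h3 with h3 | ⟨rfl, rfl⟩
  · exact Or.inl h3
  · exact Or.inr ⟨rfl, rfl⟩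

theorem affine (k : ℤ) {c : ℝ} (hc : IsDyadicReal c) (x : ℝ) :
    DyadicPLAt (fun y => 2 ^ k * y + c) x :=
  ⟨k, c, k, c, ⟨hc, .of_forall fun _ => rfl⟩, ⟨hc, .of_forall fun _ => rfl⟩, Or.inr ⟨rfl, rfl⟩⟩

theorem id (x : ℝ) : DyadicPLAt (fun y => y) x := by
  simpa using affine 0 IsDyadicReal.zero x

theorem continuousAt (hf : DyadicPLAt f x) : ContinuousAt f x := by
  obtain ⟨k, c, k', c', h1, h2, h3⟩ := hf
  rw [continuousAt_iff_continuous_left_right]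
  exact ⟨h1.tendsto_Iic.mono_right nhdsWithin_le_nhds,
    h2.tendsto_Ici.mono_right nhdsWithin_le_nhds⟩

end DyadicPLAt

/-- The group of all dyadic piecewise linear increasing homeomorphisms of the line (with a locally
finite set of break points). -/
def dyadicPL : Subgroup (ℝ ≃o ℝ) where
  carrier := {f | ∀ x, DyadicPLAt f x}
  mul_mem' := fun {f g} hf hg x => DyadicPLAt.comp (f := g) (g := f) (hf _) (hg x)
  one_mem' := DyadicPLAt.id
  inv_mem' := by
    intro f hf x
    have := (hf (f⁻¹ x)).inverse (g := (f⁻¹ : ℝ ≃o ℝ)) (.of_forall fun y => f.symm_apply_apply y)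
    rwa [show f (f⁻¹ x) = x from f.apply_symm_apply x] at this

/-! ### Gluing, the maps `shift` and `stretch`, and transitivity on pairs of dyadic points. -/

namespace DyadicPL

/-- The affine map `x ↦ 2 ^ k * x + c`. -/
noncomputable def affine (k : ℤ) (c : ℝ) : ℝ ≃o ℝ where
  toFun x := 2 ^ k * x + c
  invFun x := 2 ^ (-k) * (x - c)
  left_inv x := by rw [zpow_neg]; field_simp; ring
  right_inv x := by rw [zpow_neg]; field_simp; ring
  map_rel_iff' {x y} := by
    have : (0 : ℝ) < 2 ^ k := by positivity
    simp [this]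

@[simp] theorem affine_apply (k : ℤ) (c x : ℝ) : affine k c x = 2 ^ k * x + c := rfl

theorem affine_mem (k : ℤ) {c : ℝ} (hc : IsDyadicReal c) : affine k c ∈ dyadicPL :=
  DyadicPLAt.affine k hc

/-- The homeomorphism which is `f` to the left of `p` and `g` to the right of `p`. -/
noncomputable def glue (f g : ℝ ≃o ℝ) (p : ℝ) (h : f p = g p) : ℝ ≃o ℝ where
  toFun x := if x ≤ p then f x else g x
  invFun y := if y ≤ f p then f.symm y else g.symm y
  left_inv x := by
    by_cases hx : x ≤ p
    · simp [hx]
    · simp [hx, h]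
  right_inv y := by
    by_cases hy : y ≤ f p
    · simp [hy, OrderIso.symm_apply_le]
    · have : ¬ y ≤ g p := h ▸ hy
      simp [hy, this, OrderIso.symm_apply_le]
  map_rel_iff' {x y} := by
    have hf := f.le_iff_le (x := x) (y := y)
    have hg := g.le_iff_le (x := x) (y := y)
    have h1 := fun z => f.le_iff_le (x := z) (y := p)
    have h2 := fun z => g.le_iff_le (x := z) (y := p)
    have h3 := fun z => f.lt_iff_lt (x := p) (y := z)
    have h4 := fun z => g.lt_iff_lt (x := p) (y := z)
    simp only [Equiv.coe_fn_mk]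
    split_ifs with hx hy hy
    · exact hf
    · have a1 := (h1 x).2 hx
      have a2 := (h4 y).2 (not_le.1 hy)
      exact iff_of_true (by linarith) (by linarith)
    · have a1 := (h1 y).2 hy
      have a2 := (h4 x).2 (not_le.1 hx)
      exact iff_of_false (by linarith) (by linarith)
    · exact hg

theorem glue_of_le {f g : ℝ ≃o ℝ} {p : ℝ} (h : f p = g p) {x : ℝ} (hx : x ≤ p) :
    glue f g p h x = f x := if_pos hx

theorem glue_of_ge {f g : ℝ ≃o ℝ} {p : ℝ} (h : f p = g p) {x : ℝ} (hx : p ≤ x) :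
    glue f g p h x = g x := by
  rcases hx.eq_or_lt with rfl | hx
  · rw [glue_of_le h le_rfl, h]
  · exact if_neg hx.not_ge

theorem dyadicPLAt_glue {f g : ℝ ≃o ℝ} {p : ℝ} (h : f p = g p)
    (hf : ∀ x ≤ p, DyadicPLAt f x) (hg : ∀ x, p ≤ x → DyadicPLAt g x)
    (hp : IsDyadicReal p ∨ ∀ᶠ y in 𝓝 p, f y = g y) (x : ℝ) :
    DyadicPLAt (glue f g p h) x := by
  rcases lt_trichotomy x p with hx | rfl | hx
  · refine (hf x hx.le).congr ?_
    filter_upwards [isOpen_Iio.mem_nhds hx] with y hy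
    exact glue_of_le h (le_of_lt hy)
  · rcases hp with hp | hp
    · refine DyadicPLAt.of_germs (hf x le_rfl) (hg x le_rfl) ?_ ?_ (Or.inl hp)
      · filter_upwards [self_mem_nhdsWithin] with y hy using glue_of_le h hy
      · filter_upwards [self_mem_nhdsWithin] with y hy using glue_of_ge h hy
    · refine (hf x le_rfl).congr ?_
      filter_upwards [hp] with y hy
      rcases le_total y x with hyx | hyx
      · exact glue_of_le h hyx
      · rw [glue_of_ge h hyx, hy]
  · refine (hg x hx.le).congr ?_
    filter_upwards [isOpen_Ioi.mem_nhds hx] with y hy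
    exact glue_of_ge h (le_of_lt hy)

theorem glue_mem {f g : ℝ ≃o ℝ} (hf : f ∈ dyadicPL) (hg : g ∈ dyadicPL) {p : ℝ}
    (h : f p = g p) (hp : IsDyadicReal p) : glue f g p h ∈ dyadicPL :=
  dyadicPLAt_glue h (fun x _ => hf x) (fun x _ => hg x) (Or.inl hp)

/-- The unit translation. -/
noncomputable def shift : ℝ ≃o ℝ := affine 0 1

theorem shift_mem : shift ∈ dyadicPL := affine_mem 0 ⟨1, 0, by simp⟩

theorem shift_apply (x : ℝ) : shift x = x + 1 := by simp [shift]

theorem shift_zpow_apply (n : ℤ) (x : ℝ) : (shift ^ n) x = x + n := by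
  induction n using Int.induction_on generalizing x with
  | zero => simp
  | succ n ih =>
    rw [zpow_add_one, RelIso.mul_apply, ih, shift_apply]
    push_cast; ring
  | pred n ih =>
    have hinv : (shift⁻¹ : ℝ ≃o ℝ) x = x - 1 := by
      have : shift (x - 1) = x := by rw [shift_apply]; ring
      conv_lhs => rw [← this]
      exact shift.symm_apply_apply _
    rw [zpow_sub_one, RelIso.mul_apply, ih, hinv]
    push_cast; ring

/-- The map which is the identity to the left of `0`, doubles `[0, 1]`, and is the unit
translation to the right of `1`. -/
noncomputable def stretch : ℝ ≃o ℝ :=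
  glue 1 (glue (affine 1 0) shift 1 (by simp [shift]; norm_num)) 0
    (by rw [glue_of_le _ zero_le_one]; simp)

theorem stretch_mem : stretch ∈ dyadicPL :=
  glue_mem (one_mem _) (glue_mem (affine_mem 1 .zero) shift_mem _ ⟨1, 0, by simp⟩) _ .zero

theorem stretch_of_le {x : ℝ} (hx : x ≤ 0) : stretch x = x := glue_of_le _ hx

theorem stretch_of_mem {x : ℝ} (h0 : 0 ≤ x) (h1 : x ≤ 1) : stretch x = 2 * x := by
  rw [stretch, glue_of_ge _ h0, glue_of_le _ h1]
  simp

theorem stretch_of_ge {x : ℝ} (h1 : 1 ≤ x) : stretch x = x + 1 := by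
  rw [stretch, glue_of_ge _ (zero_le_one.trans h1), glue_of_ge _ h1, shift_apply]

theorem stretch_pow_zero (n : ℕ) : (stretch ^ n) 0 = 0 := by
  induction n with
  | zero => rfl
  | succ n ih => rw [pow_succ, RelIso.mul_apply, stretch_of_le le_rfl, ih]

theorem stretch_pow_one (n : ℕ) : (stretch ^ n) 1 = n + 1 := by
  induction n with
  | zero => simp
  | succ n ih =>
    rw [pow_succ', RelIso.mul_apply, ih, stretch_of_ge (by linarith [n.cast_nonneg (α := ℝ)])]
    push_cast; ring

/-- The length `s - r` has the form `(j + 1) / 2 ^ n`. The map `stretch ^ j` takes `[0, 1]` to `[0,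
j + 1]`, and an affine map does the rest. -/
theorem exists_unit_to {r s : ℝ} (hr : IsDyadicReal r) (hs : IsDyadicReal s) (h : r < s) :
    ∃ f ∈ dyadicPL, f 0 = r ∧ f 1 = s := by
  obtain ⟨m, n, hm⟩ := hs.sub hr
  have hm0 : 0 < m := by
    have : (0 : ℝ) < m := by
      have := sub_pos.2 h
      rw [hm] at this
      exact (div_pos_iff_of_pos_right (by positivity)).1 this
    exact_mod_cast this
  obtain ⟨j, rfl⟩ : ∃ j : ℕ, m = j + 1 := ⟨(m - 1).toNat, by omega⟩
  refine ⟨affine (-n) r * stretch ^ j, mul_mem (affine_mem _ hr) (pow_mem stretch_mem j), ?_, ?_⟩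
  · rw [RelIso.mul_apply, stretch_pow_zero]; simp
  · rw [RelIso.mul_apply, stretch_pow_one, affine_apply, zpow_neg, zpow_natCast]
    push_cast at hm
    rw [eq_comm, ← sub_eq_iff_eq_add, hm]
    ring

/-- The dyadic piecewise linear homeomorphisms act transitively on pairs of dyadic points. -/
theorem exists_map_pair {p q r s : ℝ} (hp : IsDyadicReal p) (hq : IsDyadicReal q) (hpq : p < q)
    (hr : IsDyadicReal r) (hs : IsDyadicReal s) (hrs : r < s) :
    ∃ f ∈ dyadicPL, f p = r ∧ f q = s := by
  obtain ⟨f, hf, hf0, hf1⟩ := exists_unit_to hp hq hpq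
  obtain ⟨g, hg, hg0, hg1⟩ := exists_unit_to hr hs hrs
  refine ⟨g * f⁻¹, mul_mem hg (inv_mem hf), ?_, ?_⟩
  · rw [RelIso.mul_apply, ← hf0, ← hg0]
    exact congrArg g (f.symm_apply_apply 0)
  · rw [RelIso.mul_apply, ← hf1, ← hg1]
    exact congrArg g (f.symm_apply_apply 1)

end DyadicPL

/-! ### Standard dyadic intervals, and generation of the compactly supported maps by two elements.
-/

theorem standard_of_affine {f : ℝ → ℝ} {n r : ℕ} {j k e : ℤ} (hn : (r : ℤ) + k ≤ n) (hk : k ≤ n)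
    (h : ∀ s ∈ Set.Icc (0 : ℝ) 1, f ((j + s) / 2 ^ n) = 2 ^ k * ((j + s) / 2 ^ n) + e / 2 ^ r) :
    ∃ (l : ℕ) (m : ℤ), ∀ s ∈ Set.Icc (0 : ℝ) 1, f ((j + s) / 2 ^ n) = (m + s) / 2 ^ l := by
  -- The image has length `2 ^ (k - n)`, so `l = n - k`; moreover `l ≥ r` makes the constant term an
  -- integer multiple of `2 ^ (-l)`.
  obtain ⟨l, hl⟩ : ∃ l : ℕ, (l : ℤ) = n - k := ⟨(n - k).toNat, by omega⟩
  obtain ⟨q, hq⟩ : ∃ q : ℕ, l = r + q := ⟨l - r, by omega⟩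
  refine ⟨l, j + e * 2 ^ q, fun s hs => ?_⟩
  rw [h s hs]
  have h1 : (2 : ℝ) ^ k = 2 ^ n / 2 ^ l := by
    rw [← zpow_natCast, ← zpow_natCast (2 : ℝ) l, hl, ← zpow_sub₀ two_ne_zero]
    congr 1; ring
  rw [h1, hq]
  push_cast
  field_simp
  ring

/-- A dyadic piecewise linear map sends all sufficiently small standard dyadic intervals meeting a
compact set affinely onto standard dyadic intervals of length at most one. -/
theorem exists_standard_scale {f : ℝ → ℝ} (hf : ∀ x, DyadicPLAt f x) {s : Set ℝ}
    (hs : IsCompact s) :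
    ∃ n₀ : ℕ, ∀ n ≥ n₀, ∀ j : ℤ, (∃ x ∈ s, j ≤ x * 2 ^ n ∧ x * 2 ^ n ≤ j + 1) →
      ∃ (l : ℕ) (m : ℤ), ∀ s ∈ Set.Icc (0 : ℝ) 1, f ((j + s) / 2 ^ n) = (m + s) / 2 ^ l := by
  refine hs.induction_on (p := fun s => ∃ n₀ : ℕ, ∀ n ≥ n₀, ∀ j : ℤ,
    (∃ x ∈ s, j ≤ x * 2 ^ n ∧ x * 2 ^ n ≤ j + 1) →
      ∃ (l : ℕ) (m : ℤ), ∀ s ∈ Set.Icc (0 : ℝ) 1, f ((j + s) / 2 ^ n) = (m + s) / 2 ^ l)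
    ⟨0, by simp⟩ ?_ ?_ ?_
  · rintro s t hst ⟨n₀, h⟩
    exact ⟨n₀, fun n hn j ⟨x, hx, hj⟩ => h n hn j ⟨x, hst hx, hj⟩⟩
  · rintro s t ⟨n₀, h⟩ ⟨n₁, h'⟩
    refine ⟨max n₀ n₁, fun n hn j ⟨x, hx, hj⟩ => ?_⟩
    rcases hx with hx | hx
    · exact h n ((le_max_left _ _).trans hn) j ⟨x, hx, hj⟩
    · exact h' n ((le_max_right _ _).trans hn) j ⟨x, hx, hj⟩
  · intro x _
    obtain ⟨k, c, k', c', ⟨⟨e, r, rfl⟩, h1⟩, ⟨⟨e', r', rfl⟩, h2⟩, h3⟩ := hf x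
    rw [eventually_nhdsWithin_iff, Metric.eventually_nhds_iff] at h1 h2
    obtain ⟨ε₁, hε₁, h1⟩ := h1
    obtain ⟨ε₂, hε₂, h2⟩ := h2
    obtain ⟨a, ha⟩ : ∃ a : ℕ, IsDyadicReal x → ∃ q : ℤ, x = q / 2 ^ a := by
      by_cases hx : IsDyadicReal x
      · obtain ⟨q, a, h⟩ := hx
        exact ⟨a, fun _ => ⟨q, h⟩⟩
      · exact ⟨0, fun h => absurd h hx⟩
    have hε : 0 < min ε₁ ε₂ := lt_min hε₁ hε₂
    set ε := min ε₁ ε₂ with hεdef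
    obtain ⟨b, hb⟩ := exists_pow_lt_of_lt_one (half_pos hε) (by norm_num : (1 / 2 : ℝ) < 1)
    -- The summands of the threshold: `a` puts a dyadic `x` on the grid, `b` makes the intervals
    -- shorter than `ε / 2`, `r` and `r'` clear the denominators of the constant terms, and the
    -- slopes keep the images of length at most one.
    refine ⟨Metric.ball x (ε / 2), mem_nhdsWithin_of_mem_nhds (Metric.ball_mem_nhds _ (half_pos hε)),
      a + b + r + r' + k.toNat + k'.toNat, ?_⟩
    rintro n hn j ⟨y, hy, hj1, hj2⟩
    have hpos : (0 : ℝ) < 2 ^ n := by positivity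
    have hsmall : 1 / (2 : ℝ) ^ n < ε / 2 := by
      refine lt_of_le_of_lt ?_ hb
      rw [one_div_pow]
      exact one_div_le_one_div_of_le (by positivity)
        (pow_le_pow_right₀ one_le_two (by omega))
    have hnear : ∀ s ∈ Set.Icc (0 : ℝ) 1, dist ((j + s) / 2 ^ n) x < ε := by
      intro s hs
      have e1 : dist ((j + s) / 2 ^ n) y ≤ 1 / 2 ^ n := by
        have : y = (y * 2 ^ n) / 2 ^ n := by field_simp
        rw [this, Real.dist_eq, ← sub_div, abs_div, abs_of_pos hpos]
        gcongr
        rw [abs_le]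
        constructor <;> linarith [hs.1, hs.2]
      calc dist ((j + s) / 2 ^ n) x ≤ dist ((j + s) / 2 ^ n) y + dist y x := dist_triangle _ _ _
        _ < ε := by linarith [Metric.mem_ball.1 hy]
    -- The break `x` is never interior to the interval: it is a grid point if dyadic, and otherwise
    -- there is no break at all.
    have key : (∀ s ∈ Set.Icc (0 : ℝ) 1, (j + s) / 2 ^ n ≤ x) ∨
        (∀ s ∈ Set.Icc (0 : ℝ) 1, x ≤ (j + s) / 2 ^ n) ∨ k = k' ∧ (e / 2 ^ r : ℝ) = e' / 2 ^ r' := by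
      rcases h3 with h3 | h3
      · obtain ⟨q, hq⟩ := ha h3
        have hx : x = ((q * 2 ^ (n - a) : ℤ) : ℝ) / 2 ^ n := by
          rw [hq, show n = a + (n - a) by omega, pow_add]
          push_cast
          simp only [Nat.add_sub_cancel_left]
          field_simp
        rw [hx]
        rcases lt_or_ge j (q * 2 ^ (n - a)) with hjq | hjq
        · left
          intro s hs
          have : ((j + 1 : ℤ) : ℝ) ≤ ((q * 2 ^ (n - a) : ℤ) : ℝ) := Int.cast_le.2 hjq
          push_cast at this ⊢
          gcongr
          linarith [hs.2]
        · right; left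
          intro s hs
          have : ((q * 2 ^ (n - a) : ℤ) : ℝ) ≤ (j : ℝ) := Int.cast_le.2 hjq
          gcongr
          linarith [hs.1]
      · exact Or.inr (Or.inr h3)
    rcases key with key | key | ⟨rfl, hc⟩
    · refine standard_of_affine (k := k) (r := r) (e := e) (by omega) (by omega) fun s hs => ?_
      exact h1 ((hnear s hs).trans_le (min_le_left _ _)) (key s hs)
    · refine standard_of_affine (k := k') (r := r') (e := e') (by omega) (by omega) fun s hs => ?_
      exact h2 ((hnear s hs).trans_le (min_le_right _ _)) (key s hs)
    · refine standard_of_affine (k := k) (r := r) (e := e) (by omega) (by omega) fun s hs => ?_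
      rcases le_total ((j + s) / 2 ^ n) x with hsx | hsx
      · exact h1 ((hnear s hs).trans_le (min_le_left _ _)) hsx
      · rw [hc]
        exact h2 ((hnear s hs).trans_le (min_le_right _ _)) hsx

namespace DyadicPL

/-- The conjugate of `stretch` which doubles `[j, j + 1]`. -/
noncomputable def stretchAt (j : ℤ) : ℝ ≃o ℝ := shift ^ j * stretch * shift ^ (-j)

theorem stretchAt_apply (j : ℤ) (x : ℝ) : stretchAt j x = stretch (x - j) + j := by
  rw [stretchAt, RelIso.mul_apply, RelIso.mul_apply, shift_zpow_apply, shift_zpow_apply]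
  push_cast; rw [sub_eq_add_neg]

theorem stretchAt_mem_closure (j : ℤ) :
    stretchAt j ∈ Subgroup.closure {shift, stretch} :=
  mul_mem (mul_mem (zpow_mem (Subgroup.subset_closure (by simp)) _)
    (Subgroup.subset_closure (by simp))) (zpow_mem (Subgroup.subset_closure (by simp)) _)

/-- The left fraction is in lowest terms, so it has no representation with a smaller denominator. -/
theorem eq_of_odd_div_two_pow_eq {x y : ℤ} {q p : ℕ} (hqp : q ≤ p) (h : (x : ℝ) / 2 ^ p = y / 2 ^ q)
    (hx : Odd x) : p = q ∧ x = y := by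
  obtain ⟨d, rfl⟩ := Nat.exists_eq_add_of_le hqp
  have h1 : x = y * 2 ^ d := by
    have : (x : ℝ) = y * 2 ^ d := by
      rw [pow_add] at h
      field_simp at h
      linarith
    exact_mod_cast this
  rcases d with _ | d
  · simpa using h1
  · exfalso
    rw [h1, pow_succ, ← mul_assoc] at hx
    exact (Int.not_odd_iff_even.2 (even_two.mul_left _)) hx

section Standard

variable {g : ℝ ≃o ℝ} {l : ℤ → ℕ} {m : ℤ → ℤ}

theorem standard_apply_int (h : ∀ i : ℤ, ∀ s ∈ Set.Icc (0 : ℝ) 1, g (i + s) = (m i + s) / 2 ^ l i)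
    (i : ℤ) : g i = m i / 2 ^ l i := by
  simpa using h i 0 (by simp)

theorem standard_apply_int_succ
    (h : ∀ i : ℤ, ∀ s ∈ Set.Icc (0 : ℝ) 1, g (i + s) = (m i + s) / 2 ^ l i) (i : ℤ) :
    g (i + 1) = (m i + 1) / 2 ^ l i := h i 1 (by simp)

theorem standard_eq_shift
    (h : ∀ i : ℤ, ∀ s ∈ Set.Icc (0 : ℝ) 1, g (i + s) = (m i + s) / 2 ^ l i)
    (hl : ∀ i, l i = 0) : g = shift ^ (m 0) := by
  have hm : ∀ i : ℤ, m (i + 1) = m i + 1 := by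
    intro i
    have h1 := standard_apply_int_succ h i
    have h2 := standard_apply_int h (i + 1)
    push_cast at h2
    rw [h1, hl, hl] at h2
    simp only [pow_zero, div_one] at h2
    exact_mod_cast h2.symm
  have hm' : ∀ i : ℤ, m i = m 0 + i := by
    intro i
    induction i using Int.induction_on with
    | zero => simp
    | succ i ih => rw [hm, ih]; ring
    | pred i ih =>
      have := hm (-i - 1)
      rw [sub_add_cancel, ih] at this
      linarith
  ext x
  rw [shift_zpow_apply]
  have := h ⌊x⌋ (Int.fract x) ⟨Int.fract_nonneg x, (Int.fract_lt_one x).le⟩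
  rw [Int.floor_add_fract, hl, hm'] at this
  rw [this]
  push_cast
  simp only [pow_zero, div_one]
  linarith [Int.floor_add_fract x]

/-- Take a shortest image interval. Exactly one of its ends is an odd multiple of `2 ^ (-l j)`. The
image interval on the other side of that end needs this denominator too, so by maximality of `l j`
it is equally short, and the two are the halves of one standard interval. -/
theorem exists_sibling
    (h : ∀ i : ℤ, ∀ s ∈ Set.Icc (0 : ℝ) 1, g (i + s) = (m i + s) / 2 ^ l i)
    {j : ℤ} (hmax : ∀ i, l i ≤ l j) :
    ∃ i, l i = l j ∧ l (i + 1) = l j ∧ m (i + 1) = m i + 1 ∧ Even (m i) := by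
  rcases Int.even_or_odd (m j) with hm | hm
  · have h1 := standard_apply_int_succ h j
    have h2 := standard_apply_int h (j + 1)
    push_cast at h2
    rw [h1] at h2
    obtain ⟨e1, e2⟩ := eq_of_odd_div_two_pow_eq (x := m j + 1) (hmax (j + 1)) (by push_cast; exact h2)
      hm.add_one
    exact ⟨j, rfl, e1.symm, e2.symm, hm⟩
  · have h1 := standard_apply_int_succ h (j - 1)
    have h2 := standard_apply_int h j
    push_cast at h1
    rw [sub_add_cancel, h2] at h1
    obtain ⟨e1, e2⟩ := eq_of_odd_div_two_pow_eq (y := m (j - 1) + 1) (hmax (j - 1)) (by push_cast; exact h1) hm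
    refine ⟨j - 1, e1.symm, by rw [sub_add_cancel], by rw [sub_add_cancel, e2], ?_⟩
    rw [e2] at hm
    exact (Int.not_odd_iff_even).1 fun h => Int.not_odd_iff_even.2 h.add_one hm

/-- Precomposition with `stretchAt j` merges two sibling image intervals into one of double length;
the intervals further right are re-indexed by one. -/
theorem standard_mul_stretchAt
    (h : ∀ i : ℤ, ∀ s ∈ Set.Icc (0 : ℝ) 1, g (i + s) = (m i + s) / 2 ^ l i) {j : ℤ}
    (hl : l (j + 1) = l j) (hl0 : l j ≠ 0) (hm : m (j + 1) = m j + 1) (hev : Even (m j)) (i : ℤ)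
    (s : ℝ) (hs : s ∈ Set.Icc (0 : ℝ) 1) :
    (g * stretchAt j) (i + s) =
      ((if i < j then m i else if i = j then m j / 2 else m (i + 1) : ℤ) + s) /
        2 ^ (if i < j then l i else if i = j then l j - 1 else l (i + 1)) := by
  rw [RelIso.mul_apply, stretchAt_apply]
  rcases lt_trichotomy i j with hij | rfl | hij
  · have : (i : ℝ) + 1 ≤ j := by exact_mod_cast hij
    rw [if_pos hij, if_pos hij, stretch_of_le (by linarith [hs.2]), sub_add_cancel, h i s hs]
  · simp only [lt_irrefl, if_false, if_true]
    rw [add_sub_cancel_left, stretch_of_mem hs.1 hs.2]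
    obtain ⟨q, hq⟩ := hev
    obtain ⟨p, hp⟩ := Nat.exists_eq_succ_of_ne_zero hl0
    have hq2 : m i / 2 = q := by omega
    have hfin : ((m i : ℝ) + 2 * s) / 2 ^ l i = (q + s) / 2 ^ (l i - 1) := by
      rw [hp, hq]
      push_cast
      rw [pow_succ]
      field_simp
      ring
    rw [hq2, ← hfin]
    rcases le_total (2 * s) 1 with h2 | h2
    · rw [add_comm, h i (2 * s) ⟨by linarith [hs.1], h2⟩]
    · have := h (i + 1) (2 * s - 1) ⟨by linarith, by linarith [hs.2]⟩
      push_cast at this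
      rw [show 2 * s + (i : ℝ) = i + 1 + (2 * s - 1) by ring, this, hl, hm]
      push_cast
      ring
  · have h1 : (j : ℝ) + 1 ≤ i := by exact_mod_cast hij
    rw [if_neg hij.not_gt, if_neg hij.ne', if_neg hij.not_gt, if_neg hij.ne',
      stretch_of_ge (by linarith [hs.1])]
    have := h (i + 1) s hs
    push_cast at this
    rw [← this]
    congr 1
    ring

/-- A standard map, that is, one sending all intervals `[i, i + 1]` affinely onto standard dyadic
intervals of length at most `1` (and equal to `1` outside a compact set), is a product of copies of
`shift`, `stretch` and their inverses. -/
theorem standard_mem_closure (K : ℤ) (D : ℕ) {g : ℝ ≃o ℝ} {l : ℤ → ℕ} {m : ℤ → ℤ}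
    (h : ∀ i : ℤ, ∀ s ∈ Set.Icc (0 : ℝ) 1, g (i + s) = (m i + s) / 2 ^ l i)
    (hl : ∀ i, l i ≠ 0 → -K ≤ i ∧ i < K) (hD : g K - g (-K) + D = 2 * K) :
    g ∈ Subgroup.closure {shift, stretch} := by
  -- `D` is the defect, the length of `[-K, K]` minus that of its image. Each merge of siblings
  -- fixes the value at `-K` and raises the value at `K` by one, so it uses up one unit of `D`.
  induction D generalizing g l m with
  | zero =>
    by_cases hex : ∀ i, l i = 0
    · rw [standard_eq_shift h hex]
      exact zpow_mem (Subgroup.subset_closure (by simp)) _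
    · exfalso
      push Not at hex
      obtain ⟨j, hj⟩ := hex
      have hstep : ∀ i : ℤ, g (i + 1) - g i = 1 / 2 ^ l i := by
        intro i
        rw [standard_apply_int_succ h, standard_apply_int h]
        ring
      -- No unit interval is lengthened, so the displacement at integers never increases. With
      -- defect zero it takes the same value at `-K` and `K`, which excludes a strict drop at `j`.
      have hanti : Antitone fun i : ℤ => g i - i := by
        refine antitone_int_of_succ_le fun i => ?_
        have : 1 / (2 : ℝ) ^ l i ≤ 1 := by
          rw [div_le_one (by positivity)]
          exact one_le_pow₀ one_le_two
        push_cast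
        linarith [hstep i]
      have h1 := hanti (hl j hj).1
      have h2 := hanti (Int.add_one_le_iff.2 (hl j hj).2)
      have h3 : 1 / (2 : ℝ) ^ l j < 1 := by
        rw [div_lt_one (by positivity)]
        exact one_lt_pow₀ one_lt_two hj
      have h4 := hstep j
      push_cast at h1 h2 hD
      linarith
  | succ D ih =>
    by_cases hex : ∀ i, l i = 0
    · rw [standard_eq_shift h hex]
      exact zpow_mem (Subgroup.subset_closure (by simp)) _
    · push Not at hex
      have hfin : {i | l i ≠ 0}.Finite :=
        (Set.finite_Ico (-K) K).subset fun i hi => Set.mem_Ico.2 (hl i hi)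
      obtain ⟨j, hj, hmax⟩ := Set.exists_max_image _ l hfin hex
      obtain ⟨i, hi1, hi2, hi3, hi4⟩ := exists_sibling h (j := j) fun i => by
        by_cases hi : l i = 0
        · omega
        · exact hmax i hi
      have hi0 : l i ≠ 0 := hi1 ▸ hj
      have hb := hl i hi0
      have hb' := hl (i + 1) (hi2 ▸ hj)
      have hmem := ih (g := g * stretchAt i)
        (standard_mul_stretchAt h (hi2.trans hi1.symm) hi0 hi3 hi4) ?_ ?_
      · rw [← mul_inv_cancel_right g (stretchAt i)]
        exact mul_mem hmem (inv_mem (stretchAt_mem_closure i))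
      · intro a ha
        split_ifs at ha with h1 h2
        · exact hl a ha
        · omega
        · have := hl _ ha
          omega
      · have h1 : (i : ℝ) + 1 ≤ K := by exact_mod_cast hb.2
        have h2 : (-K : ℝ) ≤ i := by exact_mod_cast hb.1
        have h3 : l K = 0 := by
          by_contra hK
          exact lt_irrefl _ (hl K hK).2
        have h4 := standard_apply_int_succ h K
        have h5 := standard_apply_int h K
        rw [h3, pow_zero, div_one] at h4 h5
        rw [RelIso.mul_apply, RelIso.mul_apply, stretchAt_apply, stretchAt_apply,
          stretch_of_ge (by linarith), stretch_of_le (by linarith), sub_add_cancel,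
          show (K : ℝ) - i + 1 + i = K + 1 by ring, h4]
        push_cast at hD
        linarith

end Standard

/-- The map sending the intervals `[i, i + 1]`, for `0 ≤ i < N * 2 ^ n`, to the successive intervals
of length `2 ^ (-n)` of `[0, N]`. -/
noncomputable def subdivide (N n : ℕ) : ℝ ≃o ℝ :=
  glue 1 (glue (affine (-n) 0) (affine 0 (N - N * 2 ^ n)) (N * 2 ^ n) (by simp; field_simp)) 0
    (by rw [glue_of_le _ (by positivity)]; simp)

theorem subdivide_of_le (N n : ℕ) {x : ℝ} (hx : x ≤ 0) : subdivide N n x = x := glue_of_le _ hx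

theorem subdivide_of_mem (N n : ℕ) {x : ℝ} (h0 : 0 ≤ x) (h1 : x ≤ N * 2 ^ n) :
    subdivide N n x = x / 2 ^ n := by
  rw [subdivide, glue_of_ge _ h0, glue_of_le _ h1]
  simp
  ring

theorem subdivide_of_ge (N n : ℕ) {x : ℝ} (h1 : N * 2 ^ n ≤ x) :
    subdivide N n x = x - N * 2 ^ n + N := by
  rw [subdivide, glue_of_ge _ (le_trans (by positivity) h1), glue_of_ge _ h1]
  simp
  ring

/-- The algebraic form of tree diagrams: `subdivide` presents the fine intervals of `[0, N]` as unit
intervals, so `f * subdivide N n` is standard. Used for `f` and for the identity, it gives `f` as a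
quotient. -/
theorem mul_subdivide_mem_closure {f : ℝ ≃o ℝ} {N n : ℕ} (h0 : ∀ x ≤ 0, f x = x)
    (hN : ∀ x : ℝ, N ≤ x → f x = x)
    (h : ∀ j : ℤ, 0 ≤ j → j < N * 2 ^ n →
      ∃ (l : ℕ) (m : ℤ), ∀ s ∈ Set.Icc (0 : ℝ) 1, f ((j + s) / 2 ^ n) = (m + s) / 2 ^ l) :
    f * subdivide N n ∈ Subgroup.closure {shift, stretch} := by
  have key : ∀ i : ℤ, ∃ (l : ℕ) (m : ℤ), (∀ s ∈ Set.Icc (0 : ℝ) 1,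
      (f * subdivide N n) (i + s) = (m + s) / 2 ^ l) ∧ (l ≠ 0 → 0 ≤ i ∧ i < N * 2 ^ n) := by
    intro i
    rcases lt_or_ge i 0 with hi | hi
    · have : (i : ℝ) + 1 ≤ 0 := by exact_mod_cast hi
      refine ⟨0, i, fun s hs => ?_, by simp⟩
      rw [RelIso.mul_apply, subdivide_of_le _ _ (by linarith [hs.2]), h0 _ (by linarith [hs.2])]
      simp
    have hi' : (0 : ℝ) ≤ i := by exact_mod_cast hi
    rcases lt_or_ge i (N * 2 ^ n) with hi2 | hi2
    · have h2 : (i : ℝ) + 1 ≤ N * 2 ^ n := by exact_mod_cast hi2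
      obtain ⟨l, m, hlm⟩ := h i hi hi2
      refine ⟨l, m, fun s hs => ?_, fun _ => ⟨hi, hi2⟩⟩
      rw [RelIso.mul_apply, subdivide_of_mem _ _ (by linarith [hs.1]) (by linarith [hs.2]),
        hlm s hs]
    · have h2 : (N * 2 ^ n : ℝ) ≤ i := by exact_mod_cast hi2
      refine ⟨0, i - N * 2 ^ n + N, fun s hs => ?_, by simp⟩
      rw [RelIso.mul_apply, subdivide_of_ge _ _ (by linarith [hs.1]), hN _ (by linarith [hs.1])]
      push_cast
      simp only [pow_zero, div_one]
      ring
  choose l m hlm hl using key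
  have hNn : N ≤ N * 2 ^ n := Nat.le_mul_of_pos_right _ (by positivity)
  -- The `N * 2 ^ n` unit intervals are squeezed into `[0, N]`, whence the defect `N * 2 ^ n - N`.
  refine standard_mem_closure (N * 2 ^ n) (N * 2 ^ n - N) hlm (fun i hi => ?_) ?_
  · have := hl i hi
    exact ⟨le_trans (by simp) this.1, this.2⟩
  · rw [RelIso.mul_apply, RelIso.mul_apply]
    push_cast [Nat.cast_sub hNn]
    rw [subdivide_of_ge _ _ le_rfl, sub_self, zero_add, hN _ le_rfl,
      subdivide_of_le _ _ (by simp), h0 _ (by simp)]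
    ring

/-- The maps `shift` and `stretch` generate all the compactly supported dyadic piecewise linear
homeomorphisms of the line. -/
theorem mem_closure_of_support {f : ℝ ≃o ℝ} (hf : f ∈ dyadicPL) {N : ℕ}
    (h : ∀ x : ℝ, x ≤ -N ∨ N ≤ x → f x = x) : f ∈ Subgroup.closure {shift, stretch} := by
  set f' : ℝ ≃o ℝ := shift ^ (N : ℤ) * f * shift ^ (-N : ℤ) with hf'def
  have hs : shift ∈ Subgroup.closure {shift, stretch} := Subgroup.subset_closure (by simp)
  have hf' : f' ∈ dyadicPL :=
    mul_mem (mul_mem (zpow_mem shift_mem _) hf) (zpow_mem shift_mem _)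
  have happ : ∀ x, f' x = f (x - N) + N := fun x => by
    rw [hf'def, RelIso.mul_apply, RelIso.mul_apply, shift_zpow_apply, shift_zpow_apply]
    push_cast; rw [sub_eq_add_neg]
  have h0 : ∀ x ≤ 0, f' x = x := fun x hx => by
    rw [happ, h _ (Or.inl (by linarith)), sub_add_cancel]
  have hN : ∀ x, ((2 * N : ℕ) : ℝ) ≤ x → f' x = x := fun x hx => by
    push_cast at hx
    rw [happ, h _ (Or.inr (by linarith)), sub_add_cancel]
  obtain ⟨n, hn⟩ := exists_standard_scale hf' (isCompact_Icc (a := (0 : ℝ)) (b := (2 * N : ℕ)))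
  have h1 : f' * subdivide (2 * N) n ∈ Subgroup.closure {shift, stretch} := by
    refine mul_subdivide_mem_closure h0 hN fun j hj0 hj => hn n le_rfl j ⟨j / 2 ^ n, ⟨?_, ?_⟩, ?_⟩
    · have : (0 : ℝ) ≤ j := by exact_mod_cast hj0
      positivity
    · rw [div_le_iff₀ (by positivity)]
      exact_mod_cast hj.le
    · rw [div_mul_cancel₀ _ (by positivity)]
      constructor <;> linarith
  have h2 : 1 * subdivide (2 * N) n ∈ Subgroup.closure {shift, stretch} :=
    mul_subdivide_mem_closure (fun _ _ => rfl) (fun _ _ => rfl)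
      fun j _ _ => ⟨n, j, fun _ _ => rfl⟩
  have h3 := mul_mem h1 (inv_mem h2)
  rw [one_mul, mul_inv_cancel_right] at h3
  have h4 : f = shift ^ (-N : ℤ) * f' * shift ^ (N : ℤ) := by
    rw [hf'def]; group
  rw [h4]
  exact mul_mem (mul_mem (zpow_mem hs _) h3) (zpow_mem hs _)

end DyadicPL

/-! ### Affine germs at a rational fixed point: the period and the contraction. -/

theorem Nat.exists_pos_dvd_two_pow_sub_one {q : ℕ} (hq : Odd q) :
    ∃ P : ℕ, 0 < P ∧ (q : ℤ) ∣ 2 ^ P - 1 := by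
  refine ⟨q.totient, Nat.totient_pos.2 hq.pos, ?_⟩
  have := Nat.ModEq.pow_totient (Nat.coprime_two_left.2 hq)
  have h := (Nat.modEq_iff_dvd.1 this.symm)
  push_cast at h
  exact h

/-- The odd part of the denominator divides some `2 ^ P - 1` by Euler's theorem, so this factor
cancels it. -/
theorem exists_pos_dyadic_of_rat {w : ℝ} (hw : w ∈ Set.range ((↑) : ℚ → ℝ)) :
    ∃ P : ℕ, 0 < P ∧ IsDyadicReal ((1 - 2 ^ (P : ℤ)) * w) := by
  obtain ⟨q, rfl⟩ := hw
  obtain ⟨r, o, ho, hr⟩ := Nat.exists_eq_two_pow_mul_odd q.den_nz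
  obtain ⟨P, hP, z, hz⟩ := Nat.exists_pos_dvd_two_pow_sub_one ho
  refine ⟨P, hP, -(z * q.num), r, ?_⟩
  have hz' : (2 : ℝ) ^ P - 1 = o * z := by exact_mod_cast hz
  have ho' : (o : ℝ) ≠ 0 := by exact_mod_cast ho.pos.ne'
  have hq : (q : ℝ) = q.num / (2 ^ r * o) := by
    conv_lhs => rw [Rat.cast_def, hr]
    push_cast; rfl
  rw [zpow_natCast, hq, show (1 : ℝ) - 2 ^ P = -(o * z) by rw [← hz']; ring]
  push_cast
  field_simp

/-- An affine map of slope `2 ^ k` fixing `w` has constant term `(1 - 2 ^ k) * w`. Such maps with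
dyadic constant term form a group, so the exponents `k` form a subgroup of `ℤ`, nontrivial because
`w` is rational. -/
theorem exists_period {w : ℝ} (hw : w ∈ Set.range ((↑) : ℚ → ℝ)) :
    ∃ P : ℕ, 0 < P ∧ ∀ k : ℤ, IsDyadicReal ((1 - 2 ^ k) * w) ↔ (P : ℤ) ∣ k := by
  let S : AddSubgroup ℤ :=
    { carrier := {k | IsDyadicReal ((1 - 2 ^ k) * w)}
      zero_mem' := by simpa using IsDyadicReal.zero
      add_mem' := by
        intro j k hj hk
        have := hj.add (hk.zpow_mul j)
        have e : (1 - (2 : ℝ) ^ j) * w + 2 ^ j * ((1 - 2 ^ k) * w) = (1 - 2 ^ (j + k)) * w := by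
          rw [zpow_add₀ two_ne_zero]; ring
        rwa [e] at this
      neg_mem' := by
        intro k hk
        have := (hk.zpow_mul (-k)).neg
        have e : -((2 : ℝ) ^ (-k) * ((1 - 2 ^ k) * w)) = (1 - 2 ^ (-k)) * w := by
          rw [zpow_neg]; field_simp; ring
        rwa [e] at this }
  obtain ⟨a, ha⟩ := Int.subgroup_cyclic S
  have hmem : ∀ k, IsDyadicReal ((1 - 2 ^ k) * w) ↔ a ∣ k := by
    intro k
    change k ∈ S ↔ _
    rw [ha, AddSubgroup.mem_closure_singleton, dvd_def]
    exact exists_congr fun n => by rw [smul_eq_mul, mul_comm, eq_comm]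
  refine ⟨a.natAbs, ?_, fun k => by rw [hmem, Int.natAbs_dvd]⟩
  obtain ⟨P, hP, h⟩ := exists_pos_dyadic_of_rat hw
  rw [hmem] at h
  rcases eq_or_ne a 0 with rfl | h0
  · rw [zero_dvd_iff] at h; omega
  · exact Int.natAbs_pos.2 h0

open Classical in
/-- For rational `w`, the positive integer `P` such that the affine maps fixing `w`, with slope
a power of `2` and dyadic constant term, are those with slope a power of `2 ^ P`. -/
noncomputable def dyadicPeriod (w : ℝ) : ℕ :=
  if h : w ∈ Set.range ((↑) : ℚ → ℝ) then (exists_period h).choose else 1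

theorem dyadicPeriod_pos (w : ℝ) : 0 < dyadicPeriod w := by
  unfold dyadicPeriod
  split_ifs with h
  · exact (exists_period h).choose_spec.1
  · exact one_pos

theorem dyadicPeriod_dvd {w : ℝ} (h : w ∈ Set.range ((↑) : ℚ → ℝ)) (k : ℤ) :
    IsDyadicReal ((1 - 2 ^ k) * w) ↔ (dyadicPeriod w : ℤ) ∣ k := by
  rw [dyadicPeriod, dif_pos h]
  exact (exists_period h).choose_spec.2 k

namespace DyadicPL

/-- The affine contraction fixing `w` whose powers are the affine maps fixing `w` which may be
germs of dyadic piecewise linear maps. -/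
noncomputable def contraction (w : ℝ) : ℝ ≃o ℝ :=
  affine (-dyadicPeriod w) ((1 - 2 ^ (-dyadicPeriod w : ℤ)) * w)

theorem contraction_mem {w : ℝ} (h : w ∈ Set.range ((↑) : ℚ → ℝ)) :
    contraction w ∈ dyadicPL :=
  affine_mem _ ((dyadicPeriod_dvd h _).2 (by simp))

theorem contraction_apply (w x : ℝ) :
    contraction w x = w + 2 ^ (-dyadicPeriod w : ℤ) * (x - w) := by
  rw [contraction, affine_apply]; ring

theorem contraction_zpow_apply (w x : ℝ) (n : ℤ) :
    (contraction w ^ n) x = w + 2 ^ (-dyadicPeriod w * n : ℤ) * (x - w) := by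
  induction n using Int.induction_on generalizing x with
  | zero => simp
  | succ n ih =>
    rw [zpow_add_one, RelIso.mul_apply, ih, contraction_apply, mul_add, zpow_add₀ two_ne_zero,
      mul_one]
    ring
  | pred n ih =>
    have hinv : ((contraction w)⁻¹ : ℝ ≃o ℝ) x = w + 2 ^ (dyadicPeriod w : ℤ) * (x - w) := by
      have : contraction w (w + 2 ^ (dyadicPeriod w : ℤ) * (x - w)) = x := by
        rw [contraction_apply, zpow_neg]; field_simp; ring
      conv_lhs => rw [← this]
      exact (contraction w).symm_apply_apply _
    rw [zpow_sub_one, RelIso.mul_apply, ih, hinv,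
      show (-dyadicPeriod w * (-n - 1) : ℤ) = -dyadicPeriod w * -n + dyadicPeriod w by ring,
      zpow_add₀ two_ne_zero]
    ring

theorem contraction_zpow_self (w : ℝ) (n : ℤ) : (contraction w ^ n) w = w := by
  rw [contraction_zpow_apply]; simp

theorem contraction_lt {w x : ℝ} (h : w < x) : contraction w x < x := by
  rw [contraction_apply]
  have : (2 : ℝ) ^ (-dyadicPeriod w : ℤ) < 1 :=
    zpow_lt_one_of_neg₀ one_lt_two (by have := dyadicPeriod_pos w; omega)
  nlinarith

theorem lt_contraction {w x : ℝ} (h : x < w) : x < contraction w x := by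
  rw [contraction_apply]
  have : (2 : ℝ) ^ (-dyadicPeriod w : ℤ) < 1 :=
    zpow_lt_one_of_neg₀ one_lt_two (by have := dyadicPeriod_pos w; omega)
  nlinarith

theorem tendsto_contraction_pow (w x : ℝ) :
    Tendsto (fun n : ℕ => (contraction w ^ (n : ℤ)) x) atTop (𝓝 w) := by
  have h1 : ∀ n : ℕ, (contraction w ^ (n : ℤ)) x =
      w + ((2 : ℝ) ^ (-dyadicPeriod w : ℤ)) ^ n * (x - w) := fun n => by
    rw [contraction_zpow_apply, zpow_mul, zpow_natCast]
  simp only [h1]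
  have h2 : (2 : ℝ) ^ (-dyadicPeriod w : ℤ) < 1 :=
    zpow_lt_one_of_neg₀ one_lt_two (by have := dyadicPeriod_pos w; omega)
  have := ((tendsto_pow_atTop_nhds_zero_of_lt_one (by positivity) h2).mul_const (x - w)).const_add w
  simpa using this

/-- The fixed point determines the constant term, and its being dyadic makes the exponent of the
slope a multiple of the period. -/
theorem germ_eq_contraction {w : ℝ} (h : w ∈ Set.range ((↑) : ℚ → ℝ)) {l : Filter ℝ} {f : ℝ → ℝ}
    {k : ℤ} {c : ℝ} (hf : IsAffGerm l f k c) (hw : w = 2 ^ k * w + c) :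
    ∃ n : ℤ, ∀ᶠ y in l, f y = (contraction w ^ n) y := by
  have hc : c = (1 - 2 ^ k) * w := by linarith
  obtain ⟨n, hn⟩ := (dyadicPeriod_dvd h k).1 (hc ▸ hf.1)
  refine ⟨-n, hf.2.mono fun y hy => ?_⟩
  rw [hy, contraction_zpow_apply, neg_mul_neg, ← hn, hc]
  ring

/-! ### Charts from the line onto an interval with rational ends. -/

section Piecewise

variable {E : ℤ → ℝ ≃o ℝ}

theorem piecewise_eq_of_mem (hE : ∀ n : ℤ, E n (n + 1) = E (n + 1) (n + 1)) {x : ℝ} {n : ℤ}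
    (h0 : n ≤ x) (h1 : x ≤ n + 1) : E ⌊x⌋ x = E n x := by
  rcases h1.eq_or_lt with rfl | h1
  · have : ⌊(n : ℝ) + 1⌋ = n + 1 := by simp
    rw [this, hE]
  · rw [Int.floor_eq_iff.2 ⟨h0, h1⟩]

theorem piecewise_strictMono (hE : ∀ n : ℤ, E n (n + 1) = E (n + 1) (n + 1)) :
    StrictMono fun x : ℝ => E ⌊x⌋ x := by
  have hint : StrictMono fun n : ℤ => E n n := by
    refine strictMono_int_of_lt_succ fun n => ?_
    push_cast
    rw [← hE]
    exact (E n).strictMono (lt_add_one _)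
  intro x y hxy
  rcases (Int.floor_mono hxy.le).eq_or_lt with h | h
  · change E ⌊x⌋ x < E ⌊y⌋ y
    rw [← h]
    exact (E _).strictMono hxy
  · have h1 : E ⌊x⌋ x < E ⌊x⌋ (⌊x⌋ + 1) := (E _).strictMono (Int.lt_floor_add_one x)
    have h2 := hint.monotone (Int.add_one_le_iff.2 h)
    have h3 : E ⌊y⌋ ⌊y⌋ ≤ E ⌊y⌋ y := (E _).monotone (Int.floor_le y)
    push_cast at h2
    rw [hE] at h1
    exact h1.trans_le (h2.trans h3)

theorem piecewise_dyadicPLAt (hE : ∀ n : ℤ, E n (n + 1) = E (n + 1) (n + 1))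
    (hmem : ∀ n, E n ∈ dyadicPL) (x : ℝ) : DyadicPLAt (fun x : ℝ => E ⌊x⌋ x) x := by
  by_cases hx : (⌊x⌋ : ℝ) = x
  · have hd : IsDyadicReal x := hx ▸ .intCast _
    refine DyadicPLAt.of_germs (hmem (⌊x⌋ - 1) x) (hmem ⌊x⌋ x) ?_ ?_ (Or.inl hd)
    · filter_upwards [self_mem_nhdsWithin, nhdsWithin_le_nhds (isOpen_Ioi.mem_nhds (sub_one_lt x))]
        with y hy hy'
      refine piecewise_eq_of_mem hE ?_ ?_
      · push_cast; rw [hx]; exact le_of_lt hy'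
      · push_cast; rw [hx]; simpa using hy
    · filter_upwards [self_mem_nhdsWithin, nhdsWithin_le_nhds (isOpen_Iio.mem_nhds (lt_add_one x))]
        with y hy hy'
      refine piecewise_eq_of_mem hE ?_ ?_
      · rw [hx]; exact hy
      · rw [hx]; exact le_of_lt hy'
  · refine (hmem ⌊x⌋ x).congr ?_
    have h1 : (⌊x⌋ : ℝ) < x := lt_of_le_of_ne (Int.floor_le x) hx
    filter_upwards [Ioo_mem_nhds h1 (Int.lt_floor_add_one x)] with y hy
    exact piecewise_eq_of_mem hE hy.1.le hy.2.le

end Piecewise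

/-- A dyadic piecewise linear homeomorphism from the line onto the interval `(u, v)`, conjugating
the unit translation near `+∞` to the contraction of `v` and the inverse unit translation near `-∞`
to the contraction of `u`. -/
structure Chart (u v : ℝ) where
  toFun : ℝ → ℝ
  strictMono : StrictMono toFun
  range_eq : Set.range toFun = Set.Ioo u v
  dyadicPLAt : ∀ x, DyadicPLAt toFun x
  apply_add_one : ∀ x, 0 ≤ x → toFun (x + 1) = contraction v (toFun x)
  apply_sub_one : ∀ x ≤ 0, toFun (x - 1) = contraction u (toFun x)

theorem nonempty_chart {u v : ℝ} (hu : u ∈ Set.range ((↑) : ℚ → ℝ))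
    (hv : v ∈ Set.range ((↑) : ℚ → ℝ)) (huv : u < v) : Nonempty (Chart u v) := by
  obtain ⟨d, hd, hud, hdv⟩ := IsDyadicReal.exists_between huv
  have hdu' : IsDyadicReal (contraction u d) := (contraction_mem hu d).dyadic_iff.2 hd
  have hdv' : IsDyadicReal (contraction v d) := (contraction_mem hv d).dyadic_iff.2 hd
  -- The interval from `d` to `contraction v d` is a fundamental domain for the contraction of `v`
  -- on `[d, v)`, and similarly for `u` on the other side. They are parametrised by `[0, 1]` and
  -- `[-1, 0]`, and equivariance dictates the chart on all other unit intervals.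
  obtain ⟨p, hp, hp0, hp1⟩ := exists_map_pair .zero ⟨1, 0, by simp⟩ zero_lt_one hd hdv'
    (lt_contraction hdv)
  obtain ⟨q, hq, hq0, hq1⟩ := exists_map_pair (p := -1) ⟨-1, 0, by simp⟩ .zero (by norm_num) hdu' hd
    (contraction_lt hud)
  let E : ℤ → ℝ ≃o ℝ := fun n =>
    if 0 ≤ n then contraction v ^ n * p * shift ^ (-n)
    else contraction u ^ (-1 - n) * q * shift ^ (-1 - n)
  have hEpos : ∀ n : ℤ, 0 ≤ n → ∀ x, E n x = (contraction v ^ n) (p (x - n)) := by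
    intro n hn x
    simp only [E, if_pos hn, RelIso.mul_apply, shift_zpow_apply]
    push_cast; rw [sub_eq_add_neg]
  have hEneg : ∀ n : ℤ, n < 0 → ∀ x, E n x = (contraction u ^ (-1 - n)) (q (x - 1 - n)) := by
    intro n hn x
    simp only [E, if_neg hn.not_ge, RelIso.mul_apply, shift_zpow_apply]
    push_cast; congr 2; ring
  have hmem : ∀ n, E n ∈ dyadicPL := by
    intro n
    by_cases hn : 0 ≤ n
    · simp only [E, if_pos hn]
      exact mul_mem (mul_mem (zpow_mem (contraction_mem hv) _) hp) (zpow_mem shift_mem _)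
    · simp only [E, if_neg hn]
      exact mul_mem (mul_mem (zpow_mem (contraction_mem hu) _) hq) (zpow_mem shift_mem _)
  have hintpos : ∀ n : ℤ, 0 ≤ n → E n n = (contraction v ^ n) d := by
    intro n hn
    rw [hEpos n hn, sub_self, hp0]
  have hintneg : ∀ n : ℤ, n ≤ 0 → E n n = (contraction u ^ (-n)) d := by
    intro n hn
    rcases hn.eq_or_lt with rfl | hn
    · rw [hintpos 0 le_rfl]; simp
    · rw [hEneg n hn, show (n : ℝ) - 1 - n = -1 by ring, hq0, ← RelIso.mul_apply,
        ← zpow_add_one]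
      congr 2; ring
  have hE : ∀ n : ℤ, E n (n + 1) = E (n + 1) (n + 1) := by
    intro n
    rcases lt_or_ge n 0 with hn | hn
    · have := hintneg (n + 1) (by omega)
      push_cast at this
      rw [this, hEneg n hn, show (n : ℝ) + 1 - 1 - n = 0 by ring, hq1]
      congr 2; ring
    · have := hintpos (n + 1) (by omega)
      push_cast at this
      rw [this, hEpos n hn, show (n : ℝ) + 1 - n = 1 by ring, hp1, ← RelIso.mul_apply,
        ← zpow_add_one]
  have hmono := piecewise_strictMono hE
  have hpl := piecewise_dyadicPLAt hE hmem
  have hcont : Continuous fun x : ℝ => E ⌊x⌋ x :=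
    continuous_iff_continuousAt.2 fun x => (hpl x).continuousAt
  have hnat : ∀ n : ℕ, E ⌊(n : ℝ)⌋ (n : ℝ) = (contraction v ^ (n : ℤ)) d := by
    intro n
    have := hintpos n (by positivity)
    simpa using this
  have hnegnat : ∀ n : ℕ, E ⌊-(n : ℝ)⌋ (-(n : ℝ)) = (contraction u ^ (n : ℤ)) d := by
    intro n
    have := hintneg (-n) (by simp)
    have e : ⌊-(n : ℝ)⌋ = -n := by
      rw [Int.floor_eq_iff]; push_cast; constructor <;> linarith
    rw [e]
    simpa using this
  refine ⟨⟨fun x => E ⌊x⌋ x, hmono, ?_, hpl, ?_, ?_⟩⟩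
  · ext y
    constructor
    · rintro ⟨x, rfl⟩
      obtain ⟨n, hn⟩ := exists_nat_ge x
      obtain ⟨n', hn'⟩ := exists_nat_ge (-x)
      constructor
      · refine lt_of_lt_of_le ?_ (hmono.monotone (neg_le.1 hn'))
        change u < E ⌊-(n' : ℝ)⌋ (-(n' : ℝ))
        have := (contraction u ^ (n' : ℤ)).strictMono hud
        rwa [contraction_zpow_self, ← hnegnat] at this
      · refine lt_of_le_of_lt (hmono.monotone hn) ?_
        change E ⌊(n : ℝ)⌋ (n : ℝ) < v
        have := (contraction v ^ (n : ℤ)).strictMono hdv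
        rwa [contraction_zpow_self, ← hnat] at this
    · rintro ⟨h1, h2⟩
      obtain ⟨n, hn⟩ := ((tendsto_contraction_pow v d).eventually (isOpen_Ioi.mem_nhds h2)).exists
      obtain ⟨n', hn'⟩ := ((tendsto_contraction_pow u d).eventually (isOpen_Iio.mem_nhds h1)).exists
      -- Surjectivity onto `(u, v)` is the intermediate value theorem: the values at integers tend
      -- to `u` and `v`.
      refine mem_range_of_exists_le_of_exists_ge hcont ⟨-n', ?_⟩ ⟨n, ?_⟩
      · rw [hnegnat]; exact le_of_lt hn'
      · rw [hnat]; exact le_of_lt hn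
  · intro x hx
    have hfl : 0 ≤ ⌊x⌋ := Int.floor_nonneg.2 hx
    change E ⌊x + 1⌋ (x + 1) = contraction v (E ⌊x⌋ x)
    rw [Int.floor_add_one, hEpos _ (by omega), hEpos _ hfl,
      ← RelIso.mul_apply (contraction v) (contraction v ^ ⌊x⌋), ← zpow_one_add,
      add_comm 1]
    congr 2
    push_cast; ring
  · intro x hx
    rw [Int.floor_sub_one]
    rcases hx.eq_or_lt with rfl | hx
    · have h1 := hintneg (-1) (by norm_num)
      have h2 := hintneg 0 le_rfl
      simp only [Int.floor_zero] 
      simp at h1 h2 ⊢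
      rw [h1, h2]
    · have hfl : ⌊x⌋ < 0 := Int.floor_lt.2 (by simpa using hx)
      rw [hEneg _ (by omega), hEneg _ hfl,
        ← RelIso.mul_apply (contraction u) (contraction u ^ (-1 - ⌊x⌋)), ← zpow_one_add]
      congr 2
      · ring
      · push_cast; ring

/-! ### Transport by a chart: realising germs and compactly supported maps in an interval. -/

theorem commute_of_forall_or {f g : ℝ ≃o ℝ} (h : ∀ x, f x = x ∨ g x = x) : Commute f g := by
  ext x
  change f (g x) = g (f x)
  rcases h x with hx | hx
  · rw [hx]
    rcases h (g x) with h' | h'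
    · exact h'
    · rw [g.injective h', hx]
  · rw [hx]
    rcases h (f x) with h' | h'
    · rw [f.injective h', hx]
    · exact h'.symm

namespace Chart

variable {u v : ℝ} (c : Chart u v)

instance : CoeFun (Chart u v) fun _ => ℝ → ℝ := ⟨Chart.toFun⟩

theorem apply_mem (x : ℝ) : c x ∈ Set.Ioo u v := c.range_eq ▸ Set.mem_range_self x

theorem exists_eq {x : ℝ} (h : x ∈ Set.Ioo u v) : ∃ z, c z = x := by
  rwa [← c.range_eq] at h

/-- The inverse of a chart. -/
noncomputable def inv : ℝ → ℝ := Function.invFun c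

theorem inv_apply (x : ℝ) : c.inv (c x) = x := Function.leftInverse_invFun c.strictMono.injective x

theorem apply_inv {x : ℝ} (h : x ∈ Set.Ioo u v) : c (c.inv x) = x := by
  obtain ⟨z, rfl⟩ := c.exists_eq h
  rw [inv_apply]

theorem inv_dyadicPLAt {x : ℝ} (h : x ∈ Set.Ioo u v) : DyadicPLAt c.inv x := by
  obtain ⟨z, rfl⟩ := c.exists_eq h
  exact (c.dyadicPLAt z).inverse (.of_forall c.inv_apply)

open Classical in
/-- Auxiliary to `Chart.transport`: the conjugate of `f` by a chart, extended by the identity. -/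
noncomputable def transportFun (f : ℝ ≃o ℝ) (x : ℝ) : ℝ :=
  if x ∈ Set.Ioo u v then c (f (c.inv x)) else x

theorem transportFun_apply (f : ℝ ≃o ℝ) (x : ℝ) : c.transportFun f (c x) = c (f x) := by
  rw [transportFun, if_pos (c.apply_mem x), inv_apply]

theorem transportFun_of_notMem (f : ℝ ≃o ℝ) {x : ℝ} (h : x ∉ Set.Ioo u v) :
    c.transportFun f x = x := if_neg h

theorem transportFun_mul (f g : ℝ ≃o ℝ) (x : ℝ) :
    c.transportFun (f * g) x = c.transportFun f (c.transportFun g x) := by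
  by_cases h : x ∈ Set.Ioo u v
  · obtain ⟨z, rfl⟩ := c.exists_eq h
    simp only [transportFun_apply, RelIso.mul_apply]
  · simp only [c.transportFun_of_notMem _ h]

theorem transportFun_one (x : ℝ) : c.transportFun 1 x = x := by
  by_cases h : x ∈ Set.Ioo u v
  · obtain ⟨z, rfl⟩ := c.exists_eq h
    simp only [transportFun_apply, RelIso.one_apply]
  · simp only [c.transportFun_of_notMem _ h]

theorem transportFun_mono (f : ℝ ≃o ℝ) : Monotone (c.transportFun f) := by
  have key : ∀ z, c.transportFun f (c z) ∈ Set.Ioo u v := fun z => by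
    rw [transportFun_apply]; exact c.apply_mem _
  intro x y hxy
  by_cases hx : x ∈ Set.Ioo u v
  · by_cases hy : y ∈ Set.Ioo u v
    · obtain ⟨z, rfl⟩ := c.exists_eq hx
      obtain ⟨z', rfl⟩ := c.exists_eq hy
      rw [transportFun_apply, transportFun_apply, c.strictMono.le_iff_le, f.le_iff_le]
      exact c.strictMono.le_iff_le.1 hxy
    · obtain ⟨z, rfl⟩ := c.exists_eq hx
      rw [c.transportFun_of_notMem f hy]
      by_contra hlt
      exact hy ⟨hx.1.trans_le hxy, (not_le.1 hlt).trans (key z).2⟩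
  · by_cases hy : y ∈ Set.Ioo u v
    · obtain ⟨z, rfl⟩ := c.exists_eq hy
      rw [c.transportFun_of_notMem f hx]
      by_contra hlt
      exact hx ⟨(key z).1.trans (not_le.1 hlt), hxy.trans_lt hy.2⟩
    · rwa [c.transportFun_of_notMem f hx, c.transportFun_of_notMem f hy]

/-- Conjugation by a chart, extended by the identity outside the interval `(u, v)`. -/
noncomputable def transport : (ℝ ≃o ℝ) →* (ℝ ≃o ℝ) where
  toFun f :=
    { toFun := c.transportFun f
      invFun := c.transportFun f⁻¹
      left_inv := fun x => by rw [← transportFun_mul, inv_mul_cancel, transportFun_one]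
      right_inv := fun x => by rw [← transportFun_mul, mul_inv_cancel, transportFun_one]
      map_rel_iff' := fun {x y} => by
        refine ⟨fun h => ?_, fun h => c.transportFun_mono f h⟩
        have := c.transportFun_mono f⁻¹ h
        simpa only [Equiv.coe_fn_mk, ← transportFun_mul, inv_mul_cancel, transportFun_one] using this }
  map_one' := by ext x; exact c.transportFun_one x
  map_mul' f g := by ext x; exact c.transportFun_mul f g x

theorem transport_apply (f : ℝ ≃o ℝ) (x : ℝ) : c.transport f (c x) = c (f x) :=
  c.transportFun_apply f x

theorem transport_of_notMem (f : ℝ ≃o ℝ) {x : ℝ} (h : x ∉ Set.Ioo u v) : c.transport f x = x :=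
  if_neg h

theorem transport_dyadicPLAt {f : ℝ ≃o ℝ} (hf : f ∈ dyadicPL) {x : ℝ} (h : x ∈ Set.Ioo u v) :
    DyadicPLAt (c.transport f) x := by
  have h1 : DyadicPLAt (fun y => c (f (c.inv y))) x :=
    DyadicPLAt.comp (f := fun y => f (c.inv y)) (c.dyadicPLAt _)
      (DyadicPLAt.comp (g := f) (hf _) (c.inv_dyadicPLAt h))
  refine h1.congr ?_
  filter_upwards [isOpen_Ioo.mem_nhds h] with y hy
  exact if_pos hy

/-- Pulling `f` back by the chart works because `f` preserves `(u, v)`; being the identity near both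
ends, it becomes compactly supported on the line. -/
theorem exists_transport_eq {f : ℝ ≃o ℝ} (hf : ∀ x ∈ Set.Ioo u v, DyadicPLAt f x) {p q : ℝ}
    (hp : p ∈ Set.Ioo u v) (hq : q ∈ Set.Ioo u v) (hfix : ∀ x, x ≤ p ∨ q ≤ x → f x = x) :
    ∃ g ∈ dyadicPL, c.transport g = f ∧ ∃ N : ℕ, ∀ x : ℝ, x ≤ -N ∨ N ≤ x → g x = x := by
  have hmaps : ∀ x, x ∈ Set.Ioo u v ↔ f x ∈ Set.Ioo u v := by
    have hu : f u = u := hfix u (Or.inl hp.1.le)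
    have hv : f v = v := hfix v (Or.inr hq.2.le)
    intro x
    rw [Set.mem_Ioo, Set.mem_Ioo, ← f.lt_iff_lt, hu, ← f.lt_iff_lt (y := v), hv]
  have hmaps' : ∀ x ∈ Set.Ioo u v, f.symm x ∈ Set.Ioo u v := fun x hx => by
    rw [hmaps, f.apply_symm_apply]; exact hx
  let g : ℝ ≃o ℝ :=
    { toFun := fun x => c.inv (f (c x))
      invFun := fun x => c.inv (f.symm (c x))
      left_inv := fun x => by
        dsimp only
        rw [c.apply_inv ((hmaps _).1 (c.apply_mem x)), f.symm_apply_apply, inv_apply]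
      right_inv := fun x => by
        dsimp only
        rw [c.apply_inv (hmaps' _ (c.apply_mem x)), f.apply_symm_apply, inv_apply]
      map_rel_iff' := fun {x y} => by
        simp only [Equiv.coe_fn_mk]
        rw [← c.strictMono.le_iff_le, c.apply_inv ((hmaps _).1 (c.apply_mem x)),
          c.apply_inv ((hmaps _).1 (c.apply_mem y)), f.le_iff_le, c.strictMono.le_iff_le] }
  refine ⟨g, fun x => ?_, ?_, ?_⟩
  · exact DyadicPLAt.comp (f := fun y => f (c y))
      (c.inv_dyadicPLAt ((hmaps _).1 (c.apply_mem x)))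
      (DyadicPLAt.comp (hf _ (c.apply_mem x)) (c.dyadicPLAt x))
  · ext x
    by_cases h : x ∈ Set.Ioo u v
    · obtain ⟨z, rfl⟩ := c.exists_eq h
      rw [transport_apply]
      exact c.apply_inv ((hmaps _).1 h)
    · rw [transport_of_notMem _ _ h]
      rcases le_or_gt x u with hx | hx
      · exact (hfix x (Or.inl (hx.trans hp.1.le))).symm
      · have : v ≤ x := not_lt.1 fun h' => h ⟨hx, h'⟩
        exact (hfix x (Or.inr (hq.2.le.trans this))).symm
  · obtain ⟨N, hN⟩ := exists_nat_ge (max (c.inv q) (-c.inv p))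
    refine ⟨N, fun x hx => ?_⟩
    have hx' : c x ≤ p ∨ q ≤ c x := by
      rw [← c.apply_inv hp, ← c.apply_inv hq, c.strictMono.le_iff_le, c.strictMono.le_iff_le]
      refine hx.imp (fun h => ?_) fun h => ?_
      · linarith [(le_max_right _ _).trans hN]
      · exact ((le_max_left _ _).trans hN).trans h
    change c.inv (f (c x)) = x
    rw [hfix _ hx', inv_apply]

/-- The transported map which is the contraction of `u` near `u` and the identity near `v`. -/
noncomputable def leftGen : ℝ ≃o ℝ := c.transport (stretch * shift⁻¹)

/-- The transported map which is the identity near `u` and the contraction of `v` near `v`. -/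
noncomputable def rightGen : ℝ ≃o ℝ := c.transport stretch

theorem leftGen_of_mem {x : ℝ} (h0 : u ≤ x) (h1 : x ≤ c 0) : c.leftGen x = contraction u x := by
  rcases h0.eq_or_lt with rfl | h0
  · rw [leftGen, transport_of_notMem _ _ (by simp), contraction_apply]; simp
  · obtain ⟨z, rfl⟩ := c.exists_eq ⟨h0, h1.trans_lt (c.apply_mem 0).2⟩
    have hz := c.strictMono.le_iff_le.1 h1
    have hs : (shift⁻¹ : ℝ ≃o ℝ) z = z - 1 := by
      have := shift_zpow_apply (-1) z
      rw [zpow_neg_one] at this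
      rw [this]; push_cast; ring
    rw [leftGen, transport_apply, RelIso.mul_apply, hs, stretch_of_le (by linarith),
      c.apply_sub_one z hz]

theorem leftGen_of_ge {x : ℝ} (h : c 2 ≤ x) : c.leftGen x = x := by
  by_cases hx : x ∈ Set.Ioo u v
  · obtain ⟨z, rfl⟩ := c.exists_eq hx
    have hz := c.strictMono.le_iff_le.1 h
    have hs : (shift⁻¹ : ℝ ≃o ℝ) z = z - 1 := by
      have := shift_zpow_apply (-1) z
      rw [zpow_neg_one] at this
      rw [this]; push_cast; ring
    rw [leftGen, transport_apply, RelIso.mul_apply, hs, stretch_of_ge (by linarith),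
      sub_add_cancel]
  · exact c.transport_of_notMem _ hx

theorem leftGen_of_le {x : ℝ} (h : x ≤ u) : c.leftGen x = x :=
  c.transport_of_notMem _ fun hx => h.not_gt hx.1

theorem rightGen_of_ge {x : ℝ} (h : v ≤ x) : c.rightGen x = x :=
  c.transport_of_notMem _ fun hx => h.not_gt hx.2

theorem rightGen_of_le {x : ℝ} (h : x ≤ c 0) : c.rightGen x = x := by
  by_cases hx : x ∈ Set.Ioo u v
  · obtain ⟨z, rfl⟩ := c.exists_eq hx
    rw [rightGen, transport_apply, stretch_of_le (c.strictMono.le_iff_le.1 h)]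
  · exact c.transport_of_notMem _ hx

theorem rightGen_of_mem {x : ℝ} (h0 : c 1 ≤ x) (h1 : x ≤ v) : c.rightGen x = contraction v x := by
  rcases h1.eq_or_lt with rfl | h1
  · rw [rightGen, transport_of_notMem _ _ (by simp), contraction_apply]; simp
  · obtain ⟨z, rfl⟩ := c.exists_eq ⟨(c.apply_mem 1).1.trans_le h0, h1⟩
    have hz := c.strictMono.le_iff_le.1 h0
    rw [rightGen, transport_apply, stretch_of_ge hz, c.apply_add_one z (by linarith)]

/-- `Γ` need not contain `leftGen` and `rightGen` but only their products with `α` and `β`, which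
act elsewhere and commute with all transported maps. A word in `shift` and `stretch` thus lifts to
`Γ` with powers of `α` and `β` attached, and the exponents are the translation lengths of the word
near `-∞` and `+∞`. -/
theorem exists_mem_of_mem_closure {Γ : Subgroup (ℝ ≃o ℝ)} {α β : ℝ ≃o ℝ}
    (hα : ∀ x ∈ Set.Ioo u v, α x = x) (hβ : ∀ x ∈ Set.Ioo u v, β x = x) (hαβ : Commute α β)
    (hA : c.leftGen * α ∈ Γ) (hB : c.rightGen * β ∈ Γ) {w : ℝ ≃o ℝ}
    (hw : w ∈ Subgroup.closure {shift, stretch}) :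
    ∃ k l : ℤ, (∀ᶠ x in atBot, w x = x - k) ∧ (∀ᶠ x in atTop, w x = x + l) ∧
      c.transport w * (α ^ k * β ^ l) ∈ Γ := by
  have hcα : ∀ f, Commute α (c.transport f) := fun f => commute_of_forall_or fun x => by
    by_cases hx : x ∈ Set.Ioo u v
    · exact Or.inl (hα x hx)
    · exact Or.inr (c.transport_of_notMem f hx)
  have hcβ : ∀ f, Commute β (c.transport f) := fun f => commute_of_forall_or fun x => by
    by_cases hx : x ∈ Set.Ioo u v
    · exact Or.inl (hβ x hx)
    · exact Or.inr (c.transport_of_notMem f hx)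
  have hc : ∀ (k l : ℤ) f, Commute (α ^ k * β ^ l) (c.transport f) := fun k l f =>
    ((hcα f).zpow_left k).mul_left ((hcβ f).zpow_left l)
  induction hw using Subgroup.closure_induction with
  | mem x hx =>
    rcases hx with rfl | rfl
    -- `shift = (stretch * shift⁻¹)⁻¹ * stretch`, so `leftGen` enters with exponent `-1` and
    -- `rightGen` with exponent `1`.
    · refine ⟨-1, 1, .of_forall fun x => ?_, .of_forall fun x => ?_, ?_⟩
      · rw [shift_apply]; push_cast; ring
      · rw [shift_apply]; push_cast; ring
      · have h1 := mul_mem (inv_mem hA) hB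
        have h2 : (c.leftGen * α)⁻¹ * (c.rightGen * β) =
            c.transport shift * (α ^ (-1 : ℤ) * β ^ (1 : ℤ)) := by
          have e : c.transport shift = c.leftGen⁻¹ * c.rightGen := by
            rw [leftGen, rightGen, ← map_inv, ← map_mul]
            congr 1; group
          have e1 : Commute α⁻¹ c.leftGen⁻¹ := ((hcα _).inv_left).inv_right
          have e2 : Commute α⁻¹ c.rightGen := (hcα _).inv_left
          rw [mul_inv_rev, e1.eq, e, zpow_neg_one, zpow_one, mul_assoc, mul_assoc,
            ← mul_assoc α⁻¹, e2.eq, mul_assoc]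
        exact h2 ▸ h1
    · refine ⟨0, 1, ?_, ?_, ?_⟩
      · filter_upwards [eventually_le_atBot 0] with x hx
        rw [stretch_of_le hx]; simp
      · filter_upwards [eventually_ge_atTop 1] with x hx
        rw [stretch_of_ge hx]; simp
      · simpa [rightGen] using hB
  | one => exact ⟨0, 0, by simp, by simp, by simp⟩
  | mul f g _ _ hf hg =>
    obtain ⟨k, l, h1, h2, h3⟩ := hf
    obtain ⟨k', l', h1', h2', h3'⟩ := hg
    refine ⟨k + k', l + l', ?_, ?_, ?_⟩
    · have ht : Tendsto (fun x : ℝ => x - k') atBot atBot := tendsto_atBot_add_const_right _ _ tendsto_id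
      filter_upwards [h1', ht.eventually h1] with x e1 e2
      rw [RelIso.mul_apply, e1, e2]; push_cast; ring
    · have ht : Tendsto (fun x : ℝ => x + l') atTop atTop := tendsto_atTop_add_const_right _ _ tendsto_id
      filter_upwards [h2', ht.eventually h2] with x e1 e2
      rw [RelIso.mul_apply, e1, e2]; push_cast; ring
    · have e := mul_mem h3 h3'
      have e1 : α ^ (k + k') * β ^ (l + l') = (α ^ k * β ^ l) * (α ^ k' * β ^ l') := by
        rw [zpow_add, zpow_add, mul_assoc, mul_assoc, ← mul_assoc (β ^ l),
          ← (hαβ.zpow_zpow k' l).eq, mul_assoc]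
      rw [map_mul, e1]
      rw [mul_assoc, ← mul_assoc (α ^ k * β ^ l), (hc k l g).eq] at e
      simpa only [mul_assoc] using e
  | inv f _ hf =>
    obtain ⟨k, l, h1, h2, h3⟩ := hf
    refine ⟨-k, -l, ?_, ?_, ?_⟩
    · have ht : Tendsto (fun x : ℝ => x + k) atBot atBot := tendsto_atBot_add_const_right _ _ tendsto_id
      filter_upwards [ht.eventually h1] with x e1
      rw [add_sub_cancel_right] at e1
      rw [← f.injective.eq_iff]
      rw [show f (f⁻¹ x) = x from f.apply_symm_apply x]
      push_cast; rw [sub_neg_eq_add, e1]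
    · have ht : Tendsto (fun x : ℝ => x - l) atTop atTop := tendsto_atTop_add_const_right _ _ tendsto_id
      filter_upwards [ht.eventually h2] with x e1
      rw [sub_add_cancel] at e1
      rw [← f.injective.eq_iff]
      rw [show f (f⁻¹ x) = x from f.apply_symm_apply x]
      push_cast; rw [← sub_eq_add_neg, e1]
    · have e := inv_mem h3
      rw [mul_inv_rev, (hc k l f).inv_inv.eq, mul_inv_rev, ← zpow_neg, ← zpow_neg,
        ← (hαβ.zpow_zpow _ _).eq, ← map_inv] at e
      exact e

/-- A subgroup containing products of `leftGen` and `rightGen` with maps supported elsewhere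
contains all the dyadic piecewise linear maps with compact support in `(u, v)`. -/
theorem mem_of_support {Γ : Subgroup (ℝ ≃o ℝ)} {α β : ℝ ≃o ℝ}
    (hα : ∀ x ∈ Set.Ioo u v, α x = x) (hβ : ∀ x ∈ Set.Ioo u v, β x = x) (hαβ : Commute α β)
    (hA : c.leftGen * α ∈ Γ) (hB : c.rightGen * β ∈ Γ) {f : ℝ ≃o ℝ}
    (hf : ∀ x ∈ Set.Ioo u v, DyadicPLAt f x) {p q : ℝ}
    (hp : p ∈ Set.Ioo u v) (hq : q ∈ Set.Ioo u v) (hfix : ∀ x, x ≤ p ∨ q ≤ x → f x = x) :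
    f ∈ Γ := by
  obtain ⟨g, hg, rfl, N, hN⟩ := c.exists_transport_eq hf hp hq hfix
  obtain ⟨k, l, h1, h2, h3⟩ :=
    c.exists_mem_of_mem_closure hα hβ hαβ hA hB (mem_closure_of_support hg hN)
  -- Compact support makes both translation lengths vanish, so the factors `α` and `β` disappear.
  obtain ⟨x, hx1, hx2⟩ := (h1.and (eventually_le_atBot (-N : ℝ))).exists
  obtain ⟨y, hy1, hy2⟩ := (h2.and (eventually_ge_atTop (N : ℝ))).exists
  rw [hN x (Or.inl hx2)] at hx1
  rw [hN y (Or.inr hy2)] at hy1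
  have hk : k = 0 := by
    have : (k : ℝ) = 0 := by linarith
    exact_mod_cast this
  have hl : l = 0 := by
    have : (l : ℝ) = 0 := by linarith
    exact_mod_cast this
  simpa [hk, hl] using h3

end Chart

end DyadicPL

/-! ### A lower bound for the number of generators. -/

theorem Group.card_le_card_of_closure_eq_top {G ι : Type*} [Group G] [Fintype ι]
    (φ : ι → G →* Multiplicative ℤ) (τ : ι → G) (hne : ∀ i, φ i (τ i) ≠ 1)
    (hd : ∀ i j, i ≠ j → φ i (τ j) = 1) {S : Finset G}
    (hS : Subgroup.closure (S : Set G) = ⊤) : Fintype.card ι ≤ S.card := by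
  classical
  -- The values of the homomorphisms form a vector in `ℚ ^ ι`. The vectors of a generating set span
  -- those of all elements, and the `τ i` give nonzero multiples of the basis vectors.
  let v : G → ι → ℚ := fun g i => ((φ i g).toAdd : ℚ)
  have hv1 : v 1 = 0 := by ext i; simp [v]
  have hvm : ∀ g h, v (g * h) = v g + v h := fun g h => by ext i; simp [v]
  have hvi : ∀ g, v g⁻¹ = -v g := fun g => by ext i; simp [v]
  have hspan : ∀ g, v g ∈ Submodule.span ℚ (S.image v : Set (ι → ℚ)) := by
    intro g
    have hg : g ∈ Subgroup.closure (S : Set G) := hS ▸ Subgroup.mem_top g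
    induction hg using Subgroup.closure_induction with
    | mem x hx => exact Submodule.subset_span (by simpa using ⟨x, hx, rfl⟩)
    | one => rw [hv1]; exact zero_mem _
    | mul x y _ _ hx hy => rw [hvm]; exact add_mem hx hy
    | inv x _ hx => rw [hvi]; exact neg_mem hx
  have htop : Submodule.span ℚ (S.image v : Set (ι → ℚ)) = ⊤ := by
    rw [eq_top_iff, ← (Pi.basisFun ℚ ι).span_eq, Submodule.span_le]
    rintro _ ⟨i, rfl⟩
    have h0 : v (τ i) i ≠ 0 := by
      simpa [v] using hne i
    have : Pi.basisFun ℚ ι i = (v (τ i) i)⁻¹ • v (τ i) := by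
      ext j
      rw [Pi.basisFun_apply, Pi.smul_apply, smul_eq_mul]
      rcases eq_or_ne j i with rfl | hji
      · simp [h0]
      · have : v (τ i) j = 0 := by simp [v, hd j i hji]
        simp [hji, this]
    rw [this]
    exact Submodule.smul_mem _ _ (hspan _)
  have h1 := finrank_span_finset_le_card (R := ℚ) (S.image v)
  rw [Set.finrank, htop, finrank_top, Module.finrank_fintype_fun_eq_card] at h1
  exact h1.trans Finset.card_image_le

/-! ### Germs at fixed points, their powers and their slopes. -/

namespace DyadicPL

theorem tendsto_Ici_of_fixed {f : ℝ ≃o ℝ} {w : ℝ} (h : f w = w) :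
    Tendsto f (𝓝[≥] w) (𝓝[≥] w) := by
  have := f.continuous.continuousAt (x := w)
  rw [ContinuousAt, h] at this
  refine tendsto_nhdsWithin_iff.2 ⟨this.mono_left nhdsWithin_le_nhds, ?_⟩
  filter_upwards [self_mem_nhdsWithin] with y hy
  have := f.monotone hy
  rwa [h] at this

theorem tendsto_Iic_of_fixed {f : ℝ ≃o ℝ} {w : ℝ} (h : f w = w) :
    Tendsto f (𝓝[≤] w) (𝓝[≤] w) := by
  have := f.continuous.continuousAt (x := w)
  rw [ContinuousAt, h] at this
  refine tendsto_nhdsWithin_iff.2 ⟨this.mono_left nhdsWithin_le_nhds, ?_⟩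
  filter_upwards [self_mem_nhdsWithin] with y hy
  have := f.monotone hy
  rwa [h] at this

theorem inv_eventuallyEq {l : Filter ℝ} {f g : ℝ ≃o ℝ} (h : ∀ᶠ y in l, f y = g y)
    (ht : Tendsto (g⁻¹ : ℝ ≃o ℝ) l l) : ∀ᶠ y in l, f⁻¹ y = g⁻¹ y := by
  filter_upwards [ht.eventually h] with y hy
  rw [show g (g⁻¹ y) = y from g.apply_symm_apply y] at hy
  conv_lhs => rw [← hy]
  exact f.symm_apply_apply _

theorem zpow_eventuallyEq {l : Filter ℝ} {f g : ℝ ≃o ℝ} (h : ∀ᶠ y in l, f y = g y)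
    (ht : Tendsto g l l) (ht' : Tendsto (g⁻¹ : ℝ ≃o ℝ) l l) (k : ℤ) :
    ∀ᶠ y in l, (f ^ k) y = (g ^ k) y := by
  induction k using Int.induction_on with
  | zero => simp
  | succ k ih =>
    filter_upwards [h, ht.eventually ih] with y h1 h2
    rw [zpow_add_one, zpow_add_one, RelIso.mul_apply, RelIso.mul_apply, h1, h2]
  | pred k ih =>
    filter_upwards [inv_eventuallyEq h ht', ht'.eventually ih] with y h1 h2
    rw [zpow_sub_one, zpow_sub_one, RelIso.mul_apply, RelIso.mul_apply, h1, h2]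

/-- If `f` and `g` have the same germ `γ ^ k` and `γ`, then `g ^ (-k) * f` has trivial germ. -/
theorem zpow_neg_mul_eventually {l : Filter ℝ} {f g γ : ℝ ≃o ℝ} {k : ℤ}
    (hf : ∀ᶠ y in l, f y = (γ ^ k) y) (hg : ∀ᶠ y in l, g y = γ y)
    (ht : ∀ k : ℤ, Tendsto (γ ^ k : ℝ ≃o ℝ) l l) : ∀ᶠ y in l, (g ^ (-k) * f) y = y := by
  have h1 := zpow_eventuallyEq hg (by simpa using ht 1) (by simpa using ht (-1)) (-k)
  filter_upwards [hf, (ht k).eventually h1] with y e1 e2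
  rw [RelIso.mul_apply, e1, e2, ← RelIso.mul_apply, ← zpow_add, neg_add_cancel, zpow_zero]
  rfl

theorem tendsto_contraction_zpow_Ici (w : ℝ) (k : ℤ) :
    Tendsto (contraction w ^ k : ℝ ≃o ℝ) (𝓝[≥] w) (𝓝[≥] w) :=
  tendsto_Ici_of_fixed (contraction_zpow_self w k)

theorem tendsto_contraction_zpow_Iic (w : ℝ) (k : ℤ) :
    Tendsto (contraction w ^ k : ℝ ≃o ℝ) (𝓝[≤] w) (𝓝[≤] w) :=
  tendsto_Iic_of_fixed (contraction_zpow_self w k)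

open Classical in
/-- The binary logarithm of the slope of `f` along `l`. -/
noncomputable def logSlope (l : Filter ℝ) (f : ℝ → ℝ) : ℤ :=
  if h : ∃ k c, IsAffGerm l f k c then h.choose else 0

theorem logSlope_Ici {x : ℝ} {f : ℝ → ℝ} {k : ℤ} {c : ℝ} (h : IsAffGerm (𝓝[≥] x) f k c) :
    logSlope (𝓝[≥] x) f = k := by
  have hex : ∃ k c, IsAffGerm (𝓝[≥] x) f k c := ⟨k, c, h⟩
  rw [logSlope, dif_pos hex]
  exact (hex.choose_spec.choose_spec.unique_Ici h).1

theorem logSlope_Iic {x : ℝ} {f : ℝ → ℝ} {k : ℤ} {c : ℝ} (h : IsAffGerm (𝓝[≤] x) f k c) :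
    logSlope (𝓝[≤] x) f = k := by
  have hex : ∃ k c, IsAffGerm (𝓝[≤] x) f k c := ⟨k, c, h⟩
  rw [logSlope, dif_pos hex]
  exact (hex.choose_spec.choose_spec.unique_Iic h).1

theorem logSlope_Ici_mul {x : ℝ} {f g : ℝ ≃o ℝ} (hf : f ∈ dyadicPL) (hg : g ∈ dyadicPL)
    (hx : g x = x) : logSlope (𝓝[≥] x) (f * g : ℝ ≃o ℝ) =
      logSlope (𝓝[≥] x) f + logSlope (𝓝[≥] x) g := by
  obtain ⟨-, -, k, c, -, h, -⟩ := hf x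
  obtain ⟨-, -, k', c', -, h', -⟩ := hg x
  rw [logSlope_Ici h, logSlope_Ici h',
    logSlope_Ici (f := (f * g : ℝ ≃o ℝ)) (h.comp h' (tendsto_Ici_of_fixed hx))]

theorem logSlope_Iic_mul {x : ℝ} {f g : ℝ ≃o ℝ} (hf : f ∈ dyadicPL) (hg : g ∈ dyadicPL)
    (hx : g x = x) : logSlope (𝓝[≤] x) (f * g : ℝ ≃o ℝ) =
      logSlope (𝓝[≤] x) f + logSlope (𝓝[≤] x) g := by
  obtain ⟨k, c, -, -, h, -, -⟩ := hf x
  obtain ⟨k', c', -, -, h', -, -⟩ := hg x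
  rw [logSlope_Iic h, logSlope_Iic h',
    logSlope_Iic (f := (f * g : ℝ ≃o ℝ)) (h.comp h' (tendsto_Iic_of_fixed hx))]

/-- The dyadic piecewise linear homeomorphisms of the line which fix the complement of `(0, 1)` and
the set `U` pointwise. -/
def lineStabilizer (U : Set ℝ) : Subgroup (ℝ ≃o ℝ) where
  carrier := {f | f ∈ dyadicPL ∧ ∀ x, x ∉ Set.Ioo (0 : ℝ) 1 ∨ x ∈ U → f x = x}
  mul_mem' := fun {f g} hf hg => ⟨mul_mem hf.1 hg.1, fun x hx => by
    rw [RelIso.mul_apply, hg.2 x hx, hf.2 x hx]⟩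
  one_mem' := ⟨one_mem _, fun _ _ => rfl⟩
  inv_mem' := fun {f} hf => ⟨inv_mem hf.1, fun x hx => by
    conv_lhs => rw [← hf.2 x hx]
    exact f.symm_apply_apply x⟩

/-! ### Generators of the stabilizer of finitely many rational points. -/

section Subdivision

variable {w : ℕ → ℝ} (hw : StrictMono w) (c : ∀ i, Chart (w i) (w (i + 1)))

theorem leftGen_germ_right (i : ℕ) :
    ∀ᶠ y in 𝓝[≥] (w i), (c i).leftGen y = contraction (w i) y := by
  filter_upwards [self_mem_nhdsWithin,
    nhdsWithin_le_nhds (isOpen_Iio.mem_nhds ((c i).apply_mem 0).1)] with y h1 h2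
  exact (c i).leftGen_of_mem h1 (le_of_lt h2)

theorem rightGen_germ_left (i : ℕ) :
    ∀ᶠ y in 𝓝[≤] (w (i + 1)), (c i).rightGen y = contraction (w (i + 1)) y := by
  filter_upwards [self_mem_nhdsWithin,
    nhdsWithin_le_nhds (isOpen_Ioi.mem_nhds ((c i).apply_mem 1).2)] with y h1 h2
  exact (c i).rightGen_of_mem (le_of_lt h2) h1

include hw in
theorem leftGen_germ_right_of_ne {i j : ℕ} (h : j ≠ i) :
    ∀ᶠ y in 𝓝[≥] (w j), (c i).leftGen y = y := by
  rcases lt_or_gt_of_ne h with h | h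
  · filter_upwards [nhdsWithin_le_nhds (isOpen_Iio.mem_nhds (hw h))] with y hy
    exact (c i).leftGen_of_le (le_of_lt hy)
  · filter_upwards [self_mem_nhdsWithin] with y hy
    exact (c i).leftGen_of_ge (((c i).apply_mem 2).2.le.trans ((hw.monotone h).trans hy))

include hw in
theorem leftGen_germ_left (i j : ℕ) : ∀ᶠ y in 𝓝[≤] (w j), (c i).leftGen y = y := by
  rcases le_or_gt j i with h | h
  · filter_upwards [self_mem_nhdsWithin] with y hy
    exact (c i).leftGen_of_le (le_trans hy (hw.monotone h))
  · have : (c i) 2 < w j := ((c i).apply_mem 2).2.trans_le (hw.monotone h)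
    filter_upwards [nhdsWithin_le_nhds (isOpen_Ioi.mem_nhds this)] with y hy
    exact (c i).leftGen_of_ge (le_of_lt hy)

include hw in
theorem rightGen_germ_right (i j : ℕ) : ∀ᶠ y in 𝓝[≥] (w j), (c i).rightGen y = y := by
  rcases le_or_gt j i with h | h
  · have : w j < (c i) 0 := (hw.monotone h).trans_lt ((c i).apply_mem 0).1
    filter_upwards [nhdsWithin_le_nhds (isOpen_Iio.mem_nhds this)] with y hy
    exact (c i).rightGen_of_le (le_of_lt hy)
  · filter_upwards [self_mem_nhdsWithin] with y hy
    exact (c i).rightGen_of_ge ((hw.monotone h).trans hy)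

include hw in
theorem rightGen_germ_left_of_ne {i j : ℕ} (h : j ≠ i + 1) :
    ∀ᶠ y in 𝓝[≤] (w j), (c i).rightGen y = y := by
  rcases lt_or_gt_of_ne h with h | h
  · filter_upwards [self_mem_nhdsWithin] with y hy
    exact (c i).rightGen_of_le
      (le_trans hy ((hw.monotone (Nat.lt_succ_iff.1 h)).trans ((c i).apply_mem 0).1.le))
  · filter_upwards [nhdsWithin_le_nhds (isOpen_Ioi.mem_nhds (hw h))] with y hy
    exact (c i).rightGen_of_ge (le_of_lt hy)

theorem leftGen_dyadicPLAt (i : ℕ) {x : ℝ} (hx : x ≠ w i) : DyadicPLAt (c i).leftGen x := by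
  by_cases h : x ∈ Set.Ioo (w i) (w (i + 1))
  · exact (c i).transport_dyadicPLAt (mul_mem stretch_mem (inv_mem shift_mem)) h
  · refine (DyadicPLAt.id x).congr ?_
    rcases lt_or_gt_of_ne hx with h' | h'
    · filter_upwards [isOpen_Iio.mem_nhds h'] with y hy
      exact (c i).leftGen_of_le (le_of_lt hy)
    · have : (c i) 2 < x := ((c i).apply_mem 2).2.trans_le (not_lt.1 fun h2 => h ⟨h', h2⟩)
      filter_upwards [isOpen_Ioi.mem_nhds this] with y hy
      exact (c i).leftGen_of_ge (le_of_lt hy)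

theorem rightGen_dyadicPLAt (i : ℕ) {x : ℝ} (hx : x ≠ w (i + 1)) :
    DyadicPLAt (c i).rightGen x := by
  by_cases h : x ∈ Set.Ioo (w i) (w (i + 1))
  · exact (c i).transport_dyadicPLAt stretch_mem h
  · refine (DyadicPLAt.id x).congr ?_
    rcases lt_or_gt_of_ne hx with h' | h'
    · have : x < (c i) 0 := (not_lt.1 fun h2 => h ⟨h2, h'⟩).trans_lt ((c i).apply_mem 0).1
      filter_upwards [isOpen_Iio.mem_nhds this] with y hy
      exact (c i).rightGen_of_le (le_of_lt hy)
    · filter_upwards [isOpen_Ioi.mem_nhds h'] with y hy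
      exact (c i).rightGen_of_ge (le_of_lt hy)

variable (hrat : ∀ i, w i ∈ Set.range ((↑) : ℚ → ℝ))

include hrat hw

theorem leftGen_mem {i : ℕ} (h : IsDyadicReal (w i)) : (c i).leftGen ∈ dyadicPL := by
  intro x
  by_cases hx : x = w i
  · subst hx
    exact DyadicPLAt.of_germs (DyadicPLAt.id _) (contraction_mem (hrat i) _)
      (leftGen_germ_left hw c i i) (leftGen_germ_right c i) (Or.inl h)
  · exact leftGen_dyadicPLAt c i hx

theorem rightGen_mem {i : ℕ} (h : IsDyadicReal (w (i + 1))) : (c i).rightGen ∈ dyadicPL := by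
  intro x
  by_cases hx : x = w (i + 1)
  · subst hx
    exact DyadicPLAt.of_germs (contraction_mem (hrat _) _) (DyadicPLAt.id _)
      (rightGen_germ_left c i) (rightGen_germ_right hw c i (i + 1)) (Or.inl h)
  · exact rightGen_dyadicPLAt c i hx

/-- Each factor alone breaks at `w (i + 1)`, but the product is the same contraction on both sides
and is smooth there. This is why a non-dyadic point costs one generator and a dyadic point two. -/
theorem rightGen_mul_leftGen_mem (i : ℕ) :
    (c i).rightGen * (c (i + 1)).leftGen ∈ dyadicPL := by
  have hfix : (c (i + 1)).leftGen (w (i + 1)) = w (i + 1) := (c (i + 1)).leftGen_of_le le_rfl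
  intro x
  by_cases hx : x = w (i + 1)
  · subst hx
    have hγ := contraction_mem (hrat (i + 1)) (w (i + 1))
    refine DyadicPLAt.of_germs hγ hγ ?_ ?_ (Or.inr rfl)
    · filter_upwards [leftGen_germ_left hw c (i + 1) (i + 1), rightGen_germ_left c i] with y h1 h2
      rw [RelIso.mul_apply, h1, h2]
    · filter_upwards [leftGen_germ_right c (i + 1),
        (tendsto_Ici_of_fixed hfix).eventually (rightGen_germ_right hw c i (i + 1))] with y h1 h2
      rw [RelIso.mul_apply, h2, h1]
  · refine DyadicPLAt.comp (g := (c i).rightGen) (rightGen_dyadicPLAt c i fun h =>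
      hx ((c (i + 1)).leftGen.injective (h.trans hfix.symm))) (leftGen_dyadicPLAt c (i + 1) hx)

omit hrat hw

theorem leftGen_apply_of_le_or_le {i : ℕ} {x : ℝ} (h : x ≤ w i ∨ w (i + 1) ≤ x) :
    (c i).leftGen x = x :=
  (c i).transport_of_notMem _ fun hx => h.elim hx.1.not_ge hx.2.not_ge

theorem rightGen_apply_of_le_or_le {i : ℕ} {x : ℝ} (h : x ≤ w i ∨ w (i + 1) ≤ x) :
    (c i).rightGen x = x :=
  (c i).transport_of_notMem _ fun hx => h.elim hx.1.not_ge hx.2.not_ge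

open Classical in
/-- The generator of the stabilizer attached to the right germ at `w i`. -/
noncomputable def germGen (i : ℕ) : ℝ ≃o ℝ :=
  if IsDyadicReal (w i) then (c i).leftGen else (c (i - 1)).rightGen * (c i).leftGen

/-- The generators of the stabilizer of the points of `w`. -/
noncomputable def stabGen (n : ℕ) :
    Fin (n + 1) ⊕ {i : Fin (n + 1) // IsDyadicReal (w (i + 1))} → ℝ ≃o ℝ :=
  Sum.elim (fun i => germGen c i) fun i => (c i.1).rightGen

variable {n : ℕ} (h0 : w 0 = 0) (h1 : w (n + 1) = 1)

include hw h0 h1 in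
theorem apply_eq_of_le_or_le {f : ℝ ≃o ℝ} {i : ℕ} (hi : i ≤ n)
    (hf : ∀ x, x ≤ w i ∨ w (i + 1) ≤ x → f x = x) (x : ℝ)
    (hx : x ∉ Set.Ioo (0 : ℝ) 1 ∨ x ∈ w '' Set.Icc 1 n) : f x = x := by
  rcases hx with hx | ⟨j, -, rfl⟩
  · refine hf x ?_
    by_contra! h
    exact hx ⟨(h0 ▸ hw.monotone (Nat.zero_le i)).trans_lt h.1,
      h.2.trans_le (h1 ▸ hw.monotone (by omega))⟩
  · refine hf _ ((le_or_gt j i).imp (fun h => hw.monotone h) fun h => hw.monotone h)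

include hw hrat h0 h1

theorem stabGen_mem (p : Fin (n + 1) ⊕ {i : Fin (n + 1) // IsDyadicReal (w (i + 1))}) :
    stabGen c n p ∈ lineStabilizer (w '' Set.Icc 1 n) := by
  have hA : ∀ i ≤ n, ∀ x, (x ∉ Set.Ioo (0 : ℝ) 1 ∨ x ∈ w '' Set.Icc 1 n) →
      (c i).leftGen x = x := fun i hi x hx =>
    apply_eq_of_le_or_le hw h0 h1 hi (fun _ => leftGen_apply_of_le_or_le c) x hx
  have hB : ∀ i ≤ n, ∀ x, (x ∉ Set.Ioo (0 : ℝ) 1 ∨ x ∈ w '' Set.Icc 1 n) →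
      (c i).rightGen x = x := fun i hi x hx =>
    apply_eq_of_le_or_le hw h0 h1 hi (fun _ => rightGen_apply_of_le_or_le c) x hx
  rcases p with ⟨i, hi⟩ | ⟨⟨i, hi⟩, hd⟩
  · change germGen c i ∈ _
    rw [germGen]
    split_ifs with hd
    · exact ⟨leftGen_mem hw c hrat hd, hA i (by omega)⟩
    -- The subtraction `i - 1` in `germGen` is never truncated, because `w 0 = 0` is dyadic.
    · rcases i with _ | i
      · exact absurd (h0 ▸ IsDyadicReal.zero) hd
      · exact ⟨rightGen_mul_leftGen_mem hw c hrat i, fun x hx => by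
          rw [RelIso.mul_apply, hA (i + 1) (by omega) x hx]
          exact hB i (by omega) x hx⟩
  · exact ⟨rightGen_mem hw c hrat hd, hB i (by omega)⟩

theorem stabGen_closure_le :
    Subgroup.closure (Set.range (stabGen c n)) ≤ lineStabilizer (w '' Set.Icc 1 n) := by
  rw [Subgroup.closure_le]
  rintro _ ⟨p, rfl⟩
  exact stabGen_mem hw c hrat h0 h1 p

-- The factor `α` is what `germGen` carries along from the preceding interval at a non-dyadic point,
-- and is trivial at a dyadic one.
omit hrat hw h1 in
theorem exists_leftGen_mul_mem {i : ℕ} (hi : i ≤ n) : ∃ α : ℝ ≃o ℝ,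
    (∀ x, w i ≤ x → α x = x) ∧ (c i).leftGen * α ∈ Subgroup.closure (Set.range (stabGen c n)) := by
  have hmem : germGen c i ∈ Subgroup.closure (Set.range (stabGen c n)) :=
    Subgroup.subset_closure ⟨Sum.inl ⟨i, by omega⟩, rfl⟩
  rw [germGen] at hmem
  split_ifs at hmem with hd
  · exact ⟨1, fun _ _ => rfl, by simpa using hmem⟩
  · rcases i with _ | i
    · exact absurd (h0 ▸ IsDyadicReal.zero) hd
    · refine ⟨(c i).rightGen, fun x hx => rightGen_apply_of_le_or_le c (Or.inr hx), ?_⟩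
      have : Commute (c i).rightGen (c (i + 1)).leftGen := commute_of_forall_or fun x =>
        (le_total (w (i + 1)) x).imp (fun h => rightGen_apply_of_le_or_le c (Or.inr h))
          fun h => leftGen_apply_of_le_or_le c (Or.inl h)
      rwa [← this.eq]

omit hrat hw h0 in
theorem exists_rightGen_mul_mem {i : ℕ} (hi : i ≤ n) : ∃ β : ℝ ≃o ℝ,
    (∀ x ≤ w (i + 1), β x = x) ∧
      (c i).rightGen * β ∈ Subgroup.closure (Set.range (stabGen c n)) := by
  by_cases hd : IsDyadicReal (w (i + 1))
  · refine ⟨1, fun _ _ => rfl, ?_⟩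
    rw [mul_one]
    exact Subgroup.subset_closure ⟨Sum.inr ⟨⟨i, by omega⟩, hd⟩, rfl⟩
  -- The last point `1` is dyadic, so `i + 1` is still the index of a generator.
  · have hin : i ≠ n := by
      rintro rfl
      exact hd (h1 ▸ ⟨1, 0, by simp⟩)
    refine ⟨(c (i + 1)).leftGen, fun x hx => leftGen_apply_of_le_or_le c (Or.inl hx), ?_⟩
    have hmem : germGen c (i + 1) ∈ Subgroup.closure (Set.range (stabGen c n)) :=
      Subgroup.subset_closure ⟨Sum.inl ⟨i + 1, by omega⟩, rfl⟩
    rwa [germGen, if_neg hd] at hmem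

omit hrat in
theorem mem_closure_of_support_Ioo {i : ℕ} (hi : i ≤ n) {f : ℝ ≃o ℝ}
    (hf : ∀ x ∈ Set.Ioo (w i) (w (i + 1)), DyadicPLAt f x) {p q : ℝ}
    (hp : p ∈ Set.Ioo (w i) (w (i + 1))) (hq : q ∈ Set.Ioo (w i) (w (i + 1)))
    (hfix : ∀ x, x ≤ p ∨ q ≤ x → f x = x) :
    f ∈ Subgroup.closure (Set.range (stabGen c n)) := by
  obtain ⟨α, hα, hA⟩ := exists_leftGen_mul_mem c h0 hi
  obtain ⟨β, hβ, hB⟩ := exists_rightGen_mul_mem c h1 hi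
  refine (c i).mem_of_support (fun x hx => hα x hx.1.le) (fun x hx => hβ x hx.2.le)
    (commute_of_forall_or fun x => ?_) hA hB hf hp hq hfix
  rcases le_total (w i) x with h | h
  · exact Or.inl (hα x h)
  · exact Or.inr (hβ x (h.trans (hw.monotone (Nat.le_succ i))))

-- At a dyadic point the right germ is a power of the contraction, cancelled by a power of
-- `leftGen`. At a non-dyadic point there is nothing to cancel: the left germ is trivial and a break
-- is forbidden.
omit h0 h1 in
theorem exists_mul_eq_self_left {i : ℕ} (hi : i ≤ n) {f : ℝ ≃o ℝ}
    (hf : f ∈ lineStabilizer (w '' Set.Icc 1 n)) (hfix : ∀ x ≤ w i, f x = x) :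
    ∃ g ∈ Subgroup.closure (Set.range (stabGen c n)),
      ∃ p ∈ Set.Ioo (w i) (w (i + 1)), ∀ x ≤ p, (g * f) x = x := by
  suffices ∃ g ∈ Subgroup.closure (Set.range (stabGen c n)), (∀ x ≤ w i, g x = x) ∧
      ∀ᶠ y in 𝓝[≥] (w i), (g * f) y = y by
    obtain ⟨g, hg, hgfix, hev⟩ := this
    have hlt := hw (Nat.lt_succ_self i)
    obtain ⟨p, hp, hsub⟩ := (mem_nhdsGE_iff_exists_mem_Ioc_Ico_subset hlt).1 hev
    obtain ⟨q, hq1, hq2⟩ := exists_between hp.1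
    refine ⟨g, hg, q, ⟨hq1, hq2.trans_le hp.2⟩, fun x hx => ?_⟩
    rcases le_total x (w i) with h | h
    · rw [RelIso.mul_apply, hfix x h, hgfix x h]
    · exact hsub ⟨h, hx.trans_lt hq2⟩
  obtain ⟨k, d, k', d', hl, hr, hd⟩ := hf.1 (w i)
  by_cases hdy : IsDyadicReal (w i)
  · have hmem : germGen c i ∈ Subgroup.closure (Set.range (stabGen c n)) :=
      Subgroup.subset_closure ⟨Sum.inl ⟨i, by omega⟩, rfl⟩
    rw [germGen, if_pos hdy] at hmem
    obtain ⟨m, hm⟩ := germ_eq_contraction (hrat i) hr (by rw [← hr.apply_Ici, hfix _ le_rfl])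
    refine ⟨(c i).leftGen ^ (-m), zpow_mem hmem _, fun x hx => ?_,
      zpow_neg_mul_eventually hm (leftGen_germ_right c i) (tendsto_contraction_zpow_Ici _)⟩
    rw [Chart.leftGen, ← map_zpow]
    exact (c i).transport_of_notMem _ fun h => hx.not_gt h.1
  · refine ⟨1, one_mem _, fun _ _ => rfl, ?_⟩
    obtain ⟨rfl, rfl⟩ := hd.resolve_left hdy
    have hid : IsAffGerm (𝓝[≤] (w i)) f 0 0 := ⟨.zero, by
      filter_upwards [self_mem_nhdsWithin] with y hy
      rw [hfix y hy]; simp⟩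
    obtain ⟨rfl, rfl⟩ := hl.unique_Iic hid
    filter_upwards [hr.2] with y hy
    rw [one_mul, hy]; simp

-- Cancels the left germ at `w (i + 1)`. The factor `β` may spoil the map beyond `w (i + 1)`, which
-- is harmless since the intervals are cleared from left to right.
omit h0 in
theorem exists_mul_eq_self_right {i : ℕ} (hi : i ≤ n) {f : ℝ ≃o ℝ}
    (hf : f ∈ lineStabilizer (w '' Set.Icc 1 n)) (hfw : f (w (i + 1)) = w (i + 1)) {p : ℝ}
    (hp : p ∈ Set.Ioo (w i) (w (i + 1))) (hfix : ∀ x ≤ p, f x = x) :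
    ∃ g ∈ Subgroup.closure (Set.range (stabGen c n)),
      ∃ p ∈ Set.Ioo (w i) (w (i + 1)), ∃ q ∈ Set.Ioo (w i) (w (i + 1)),
        (∀ x ≤ p, (g * f) x = x) ∧ ∀ x, q ≤ x → x ≤ w (i + 1) → (g * f) x = x := by
  obtain ⟨k, d, -, -, hl, -, -⟩ := hf.1 (w (i + 1))
  obtain ⟨m, hm⟩ := germ_eq_contraction (hrat (i + 1)) hl (by rw [← hl.apply_Iic, hfw])
  obtain ⟨β, hβ, hB⟩ := exists_rightGen_mul_mem c h1 hi
  have hgerm : ∀ᶠ y in 𝓝[≤] (w (i + 1)),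
      ((c i).rightGen * β) y = contraction (w (i + 1)) y := by
    filter_upwards [self_mem_nhdsWithin, rightGen_germ_left c i] with y hy hy'
    rw [RelIso.mul_apply, hβ y hy, hy']
  have hev := zpow_neg_mul_eventually hm hgerm (tendsto_contraction_zpow_Iic _)
  obtain ⟨q, hq, hsub⟩ := (mem_nhdsLE_iff_exists_mem_Ico_Ioc_subset (hw (Nat.lt_succ_self i))).1 hev
  obtain ⟨r, hr1, hr2⟩ := exists_between hq.2
  -- Inside the interval `rightGen` is known to be the identity only up to `c i 0`, hence the
  -- minimum.
  refine ⟨_, zpow_mem hB (-m), min p ((c i) 0), ⟨lt_min hp.1 ((c i).apply_mem 0).1,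
    (min_le_left _ _).trans_lt hp.2⟩, r, ⟨hq.1.trans_lt hr1, hr2⟩, fun x hx => ?_,
    fun x hx hx' => hsub ⟨hr1.trans_le hx, hx'⟩⟩
  rw [RelIso.mul_apply, hfix x (hx.trans (min_le_left _ _))]
  have hfix1 : ((c i).rightGen * β) x = x := by
    rw [RelIso.mul_apply, hβ x (hx.trans ((min_le_left _ _).trans hp.2.le)),
      (c i).rightGen_of_le (hx.trans (min_le_right _ _))]
  exact zpow_mem (K := MulAction.stabilizer (ℝ ≃o ℝ) x) (MulAction.mem_stabilizer_iff.2 hfix1) (-m)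

/-- Once the germs at both ends of the interval after `w i` are cancelled, cutting at `w (i + 1)`
splits off a factor with compact support in that interval. The remaining factor fixes everything up
to `w (i + 1)`. -/
theorem mem_closure_of_fixes_Iic {i : ℕ} (hi : i ≤ n + 1) {f : ℝ ≃o ℝ}
    (hf : f ∈ lineStabilizer (w '' Set.Icc 1 n)) (hfix : ∀ x ≤ w i, f x = x) :
    f ∈ Subgroup.closure (Set.range (stabGen c n)) := by
  have hle := stabGen_closure_le hw c hrat h0 h1
  induction hi using Nat.decreasingInduction generalizing f with
  | self =>
    have : f = 1 := by
      ext x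
      rcases le_total x (w (n + 1)) with h | h
      · exact hfix x h
      · exact hf.2 x (Or.inl fun hx => (h1 ▸ h).not_gt hx.2)
    rw [this]
    exact one_mem _
  | of_succ i hi ih =>
    replace hi : i ≤ n := Nat.lt_succ_iff.1 hi
    obtain ⟨g, hg, p, hp, hgf⟩ := exists_mul_eq_self_left hw c hrat hi hf hfix
    have hgfH := mul_mem (hle hg) hf
    have hwi : ∀ f ∈ lineStabilizer (w '' Set.Icc 1 n), f (w (i + 1)) = w (i + 1) := by
      intro f hf
      refine hf.2 _ ?_
      rcases hi.eq_or_lt with rfl | hi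
      · left; rw [h1]; simp
      · exact Or.inr ⟨i + 1, ⟨by omega, hi⟩, rfl⟩
    obtain ⟨g', hg', p', hp', q, hq, hlow, hup⟩ :=
      exists_mul_eq_self_right hw c hrat h1 hi hgfH (hwi _ hgfH) hp hgf
    have hH := mul_mem (hle hg') hgfH
    have hglue : (g' * (g * f)) (w (i + 1)) = (1 : ℝ ≃o ℝ) (w (i + 1)) := hwi _ hH
    set F := g' * (g * f) with hF
    have hF1 : glue F 1 (w (i + 1)) hglue ∈ Subgroup.closure (Set.range (stabGen c n)) := by
      refine mem_closure_of_support_Ioo hw c h0 h1 hi (fun x hx => ?_) hp' hq fun x hx => ?_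
      · refine (hH.1 x).congr ?_
        filter_upwards [isOpen_Iio.mem_nhds hx.2] with y hy
        exact glue_of_le _ (le_of_lt hy)
      · rcases le_total x (w (i + 1)) with h | h
        · rw [glue_of_le _ h]
          exact hx.elim (hlow x) fun hx => hup x hx h
        · rw [glue_of_ge _ h]; rfl
    have hF2 : (glue F 1 (w (i + 1)) hglue)⁻¹ * F ∈ Subgroup.closure (Set.range (stabGen c n)) := by
      refine ih (mul_mem (inv_mem (hle hF1)) hH) fun x hx => ?_
      rw [RelIso.mul_apply, ← glue_of_le hglue hx]
      exact OrderIso.symm_apply_apply _ x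
    have hF3 := mul_mem hF1 hF2
    rw [mul_inv_cancel_left] at hF3
    have := mul_mem (inv_mem hg) (mul_mem (inv_mem hg') hF3)
    rwa [hF, inv_mul_cancel_left, inv_mul_cancel_left] at this

theorem stabGen_closure_eq :
    Subgroup.closure (Set.range (stabGen c n)) = lineStabilizer (w '' Set.Icc 1 n) := by
  refine le_antisymm (stabGen_closure_le hw c hrat h0 h1) fun f hf => ?_
  refine mem_closure_of_fixes_Iic hw c hrat h0 h1 (Nat.zero_le _) hf fun x hx => ?_
  exact hf.2 x (Or.inl fun h => (h0 ▸ hx).not_gt h.1)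

end Subdivision

end DyadicPL

/-! ### The rank of the stabilizer in the rational case. -/

theorem Group.exists_fg_rank_eq {G ι : Type*} [Group G] [Fintype ι]
    (φ : ι → G →* Multiplicative ℤ) (τ : ι → G) (hne : ∀ i, φ i (τ i) ≠ 1)
    (hd : ∀ i j, i ≠ j → φ i (τ j) = 1) (hτ : Subgroup.closure (Set.range τ) = ⊤) :
    ∃ _ : Group.FG G, Group.rank G = Fintype.card ι := by
  classical
  have hfg : Group.FG G := Group.fg_iff.2 ⟨_, hτ, Set.finite_range τ⟩
  refine ⟨hfg, le_antisymm ?_ ?_⟩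
  · refine (Group.rank_le (S := Finset.univ.image τ) (by simpa using hτ)).trans ?_
    exact Finset.card_image_le
  · obtain ⟨S, hS, hS'⟩ := Group.rank_spec G
    rw [← hS]
    exact Group.card_le_card_of_closure_eq_top φ τ hne hd hS'

namespace DyadicPL

theorem logSlope_Ici_eq_zero {x : ℝ} {f : ℝ → ℝ} (h : ∀ᶠ y in 𝓝[≥] x, f y = y) :
    logSlope (𝓝[≥] x) f = 0 :=
  logSlope_Ici (c := 0) ⟨.zero, h.mono fun y hy => by rw [hy]; simp⟩

theorem logSlope_Iic_eq_zero {x : ℝ} {f : ℝ → ℝ} (h : ∀ᶠ y in 𝓝[≤] x, f y = y) :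
    logSlope (𝓝[≤] x) f = 0 :=
  logSlope_Iic (c := 0) ⟨.zero, h.mono fun y hy => by rw [hy]; simp⟩

theorem isAffGerm_of_contraction {w : ℝ} (hw : w ∈ Set.range ((↑) : ℚ → ℝ)) {l : Filter ℝ}
    {f : ℝ → ℝ} (h : ∀ᶠ y in l, f y = contraction w y) :
    IsAffGerm l f (-dyadicPeriod w) ((1 - 2 ^ (-dyadicPeriod w : ℤ)) * w) :=
  ⟨(dyadicPeriod_dvd hw _).2 (by simp), h⟩

/-- The binary logarithm of the right slope at a fixed point, as a homomorphism. -/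
noncomputable def rightSlopeHom {U : Set ℝ} {x : ℝ} (hx : ∀ f ∈ lineStabilizer U, f x = x) :
    lineStabilizer U →* Multiplicative ℤ :=
  MonoidHom.mk' (fun f => .ofAdd (logSlope (𝓝[≥] x) f.1)) fun f g =>
    congrArg Multiplicative.ofAdd (logSlope_Ici_mul f.2.1 g.2.1 (hx _ g.2))

/-- The binary logarithm of the left slope at a fixed point, as a homomorphism. -/
noncomputable def leftSlopeHom {U : Set ℝ} {x : ℝ} (hx : ∀ f ∈ lineStabilizer U, f x = x) :
    lineStabilizer U →* Multiplicative ℤ :=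
  MonoidHom.mk' (fun f => .ofAdd (logSlope (𝓝[≤] x) f.1)) fun f g =>
    congrArg Multiplicative.ofAdd (logSlope_Iic_mul f.2.1 g.2.1 (hx _ g.2))

section Subdivision

variable {w : ℕ → ℝ} (hw : StrictMono w) (c : ∀ i, Chart (w i) (w (i + 1)))

include hw in
theorem germGen_germ_right (i : ℕ) :
    ∀ᶠ y in 𝓝[≥] (w i), germGen c i y = contraction (w i) y := by
  have h := leftGen_germ_right c i
  rw [germGen]
  split_ifs
  · exact h
  · filter_upwards [h, (tendsto_Ici_of_fixed ((c i).leftGen_of_le le_rfl)).eventually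
      (rightGen_germ_right hw c (i - 1) i)] with y h1 h2
    rw [RelIso.mul_apply, h2, h1]

include hw in
theorem germGen_germ_right_of_ne {i j : ℕ} (hij : j ≠ i) :
    ∀ᶠ y in 𝓝[≥] (w j), germGen c i y = y := by
  have h := leftGen_germ_right_of_ne hw c hij
  rw [germGen]
  split_ifs
  · exact h
  · filter_upwards [h, rightGen_germ_right hw c (i - 1) j] with y h1 h2
    rw [RelIso.mul_apply, h1, h2]

include hw in
theorem germGen_germ_left (h0 : w 0 = 0) (i : ℕ) {j : ℕ} (hj : IsDyadicReal (w j)) :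
    ∀ᶠ y in 𝓝[≤] (w j), germGen c i y = y := by
  have h := leftGen_germ_left hw c i j
  rw [germGen]
  split_ifs with hi
  · exact h
  · have hij : j ≠ i - 1 + 1 := by
      rcases i with _ | i
      · exact absurd (h0 ▸ IsDyadicReal.zero) hi
      · rintro rfl
        exact hi hj
    filter_upwards [h, rightGen_germ_left_of_ne hw c hij] with y h1 h2
    rw [RelIso.mul_apply, h1, h2]

variable (hrat : ∀ i, w i ∈ Set.range ((↑) : ℚ → ℝ)) {n : ℕ} (h0 : w 0 = 0) (h1 : w (n + 1) = 1)

include h0 h1 in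
theorem lineStabilizer_apply {i : ℕ} (hi : i ≤ n + 1) (f : ℝ ≃o ℝ)
    (hf : f ∈ lineStabilizer (w '' Set.Icc 1 n)) : f (w i) = w i := by
  refine hf.2 _ ?_
  rcases Nat.eq_zero_or_pos i with rfl | hpos
  · left; rw [h0]; simp
  rcases hi.eq_or_lt with rfl | hi
  · left; rw [h1]; simp
  · exact Or.inr ⟨i, ⟨hpos, by omega⟩, rfl⟩

-- The logarithms of the right slopes at `w 0, ..., w n` and of the left slopes at the dyadic points
-- among `w 1, ..., w (n + 1)` form a diagonal matrix on the generators, with nonzero diagonal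
-- entries `-dyadicPeriod`.
open Classical in
include hw hrat h0 h1 in
theorem lineStabilizer_rank (c : ∀ i, Chart (w i) (w (i + 1))) :
    ∃ _ : Group.FG (lineStabilizer (w '' Set.Icc 1 n)),
      Group.rank (lineStabilizer (w '' Set.Icc 1 n)) =
        n + 1 + Fintype.card {i : Fin (n + 1) // IsDyadicReal (w (i + 1))} := by
  let τ : Fin (n + 1) ⊕ {i : Fin (n + 1) // IsDyadicReal (w (i + 1))} →
      lineStabilizer (w '' Set.Icc 1 n) :=
    fun p => ⟨stabGen c n p, stabGen_mem hw c hrat h0 h1 p⟩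
  let φ : Fin (n + 1) ⊕ {i : Fin (n + 1) // IsDyadicReal (w (i + 1))} →
      lineStabilizer (w '' Set.Icc 1 n) →* Multiplicative ℤ :=
    Sum.elim (fun i => rightSlopeHom (lineStabilizer_apply h0 h1 (i := i) (by omega)))
      fun i => leftSlopeHom (lineStabilizer_apply h0 h1 (i := i.1 + 1) (by omega))
  have hcl : Subgroup.closure (Set.range τ) = ⊤ := by
    apply Subgroup.map_injective (lineStabilizer (w '' Set.Icc 1 n)).subtype_injective
    rw [MonoidHom.map_closure, ← Set.range_comp, ← MonoidHom.range_eq_map, Subgroup.range_subtype]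
    exact stabGen_closure_eq hw c hrat h0 h1
  have hper : ∀ x : ℝ, Multiplicative.ofAdd (-dyadicPeriod x : ℤ) ≠ 1 := fun x => by
    have := dyadicPeriod_pos x
    rw [Ne, ofAdd_eq_one]
    omega
  have hne : ∀ i, φ i (τ i) ≠ 1 := by
    rintro (i | ⟨i, hi⟩)
    · change Multiplicative.ofAdd (logSlope (𝓝[≥] (w i)) (germGen c i)) ≠ 1
      rw [logSlope_Ici (isAffGerm_of_contraction (hrat i) (germGen_germ_right hw c i))]
      exact hper _
    · change Multiplicative.ofAdd (logSlope (𝓝[≤] (w (i + 1))) (c i).rightGen) ≠ 1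
      rw [logSlope_Iic (isAffGerm_of_contraction (hrat _) (rightGen_germ_left c i))]
      exact hper _
  have hd : ∀ i j, i ≠ j → φ i (τ j) = 1 := by
    rintro (i | ⟨i, hi⟩) (j | ⟨j, hj⟩) hij
    · change Multiplicative.ofAdd (logSlope (𝓝[≥] (w i)) (germGen c j)) = 1
      rw [logSlope_Ici_eq_zero (germGen_germ_right_of_ne hw c fun h => hij ?_)]
      · rfl
      · rw [Fin.ext h]
    · change Multiplicative.ofAdd (logSlope (𝓝[≥] (w i)) (c j).rightGen) = 1
      rw [logSlope_Ici_eq_zero (rightGen_germ_right hw c j i)]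
      rfl
    · change Multiplicative.ofAdd (logSlope (𝓝[≤] (w (i + 1))) (germGen c j)) = 1
      rw [logSlope_Iic_eq_zero (germGen_germ_left hw c h0 j hi)]
      rfl
    · change Multiplicative.ofAdd (logSlope (𝓝[≤] (w (i + 1))) (c j).rightGen) = 1
      rw [logSlope_Iic_eq_zero (rightGen_germ_left_of_ne hw c fun h => hij ?_)]
      · rfl
      · have : i = j := Fin.ext (Nat.succ_injective h)
        subst this
        rfl
  obtain ⟨hfg, hr⟩ := Group.exists_fg_rank_eq φ τ hne hd hcl
  exact ⟨hfg, by rw [hr, Fintype.card_sum, Fintype.card_fin]⟩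

end Subdivision

/-- Beyond `1` the sequence continues with `2, 3, ...`, so that it is infinite and, when `U` is
rational, charts exist at every index. -/
theorem exists_strictMono_seq {U : Set ℝ} (hfin : U.Finite) (hU : U ⊆ Set.Ioo (0 : ℝ) 1) :
    ∃ w : ℕ → ℝ, StrictMono w ∧ w 0 = 0 ∧ w (U.ncard + 1) = 1 ∧ w '' Set.Icc 1 U.ncard = U ∧
      ∀ i, w i ∈ U ∨ ∃ k : ℕ, w i = k := by
  have hcard : hfin.toFinset.card = U.ncard := (Set.ncard_eq_toFinset_card U hfin).symm
  set n := U.ncard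
  let e := hfin.toFinset.orderEmbOfFin hcard
  have he : ∀ i, e i ∈ U := fun i => by
    exact hfin.mem_toFinset.1 (hfin.toFinset.orderEmbOfFin_mem hcard i)
  have heR : Set.range e = U := by
    rw [Finset.range_orderEmbOfFin]; simp
  let w : ℕ → ℝ := fun i =>
    if i = 0 then 0 else if h : i - 1 < n then e ⟨i - 1, h⟩ else (i - n : ℕ)
  have hw0 : w 0 = 0 := by simp [w]
  have hwe : ∀ (i : ℕ) (h : i < n), w (i + 1) = e ⟨i, h⟩ := fun i h => by simp [w, h]
  have hwb : ∀ i : ℕ, n ≤ i → w (i + 1) = (i + 1 - n : ℕ) := fun i h => by simp [w, h.not_gt]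
  refine ⟨w, strictMono_nat_of_lt_succ fun i => ?_, hw0, ?_, ?_, fun i => ?_⟩
  · rcases i with _ | i
    · rw [hw0]
      rcases lt_or_ge 0 n with h | h
      · rw [hwe 0 h]; exact (hU (he _)).1
      · rw [hwb 0 h]; exact_mod_cast (by omega : 0 < 0 + 1 - n)
    · rcases lt_or_ge i n with h | h
      · rw [hwe i h]
        rcases lt_or_ge (i + 1) n with h' | h'
        · rw [hwe _ h']
          exact e.strictMono (Nat.lt_succ_self i)
        · rw [hwb _ h', show i + 1 + 1 - n = 1 by omega]
          simpa using (hU (he ⟨i, h⟩)).2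
      · rw [hwb i h, hwb (i + 1) (by omega)]
        exact_mod_cast (by omega : i + 1 - n < i + 1 + 1 - n)
  · rw [hwb n le_rfl]; simp
  · conv_rhs => rw [← heR]
    ext x
    constructor
    · rintro ⟨i, ⟨hi1, hi2⟩, rfl⟩
      obtain ⟨i, rfl⟩ := Nat.exists_eq_succ_of_ne_zero (by omega : i ≠ 0)
      exact ⟨⟨i, hi2⟩, (hwe i hi2).symm⟩
    · rintro ⟨⟨i, hi⟩, rfl⟩
      exact ⟨i + 1, ⟨by omega, hi⟩, hwe i hi⟩
  · rcases i with _ | i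
    · exact Or.inr ⟨0, by rw [hw0]; simp⟩
    · rcases lt_or_ge i n with h | h
      · exact Or.inl (hwe i h ▸ he _)
      · exact Or.inr ⟨_, hwb i h⟩

theorem lineStabilizer_rank_of_rational {U : Set ℝ} (hfin : U.Finite)
    (hU : U ⊆ Set.Ioo (0 : ℝ) 1) (hrat : U ⊆ Set.range ((↑) : ℚ → ℝ)) :
    ∃ _ : Group.FG (lineStabilizer U), Group.rank (lineStabilizer U) =
      2 * (dyadicPart U).ncard + (nonDyadicRationalPart U).ncard + 2 := by
  classical
  obtain ⟨w, hw, h0, h1, himg, hmem⟩ := exists_strictMono_seq hfin hU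
  set n := U.ncard with hn
  have hwrat : ∀ i, w i ∈ Set.range ((↑) : ℚ → ℝ) := fun i => by
    rcases hmem i with h | ⟨k, hk⟩
    · exact hrat h
    · exact ⟨k, by rw [hk]; simp⟩
  have c : ∀ i, Chart (w i) (w (i + 1)) := fun i =>
    (nonempty_chart (hwrat i) (hwrat (i + 1)) (hw (Nat.lt_succ_self i))).some
  obtain ⟨hfg, hr⟩ := lineStabilizer_rank hw hwrat h0 h1 c
  have hsplit : (dyadicPart U).ncard + (nonDyadicRationalPart U).ncard = n := by
    rw [← Set.ncard_union_eq ?_ (hfin.subset fun x hx => hx.1) (hfin.subset fun x hx => hx.1)]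
    · congr 1
      ext x
      by_cases hx : IsDyadicReal x
      · simp [dyadicPart, nonDyadicRationalPart, hx]
      · simpa [dyadicPart, nonDyadicRationalPart, hx] using fun h => ⟨h, hrat h⟩
    · exact Set.disjoint_left.2 fun x hx hx' => hx'.2.2 hx.2
  -- The additional dyadic point is the end point `w (n + 1) = 1`.
  have hcard : Fintype.card {i : Fin (n + 1) // IsDyadicReal (w (i + 1))} =
      (dyadicPart U).ncard + 1 := by
    have h1U : (1 : ℝ) ∉ dyadicPart U := fun h => lt_irrefl _ (hU h.1).2
    rw [← Set.ncard_insert_of_notMem h1U (hfin.subset fun x hx => hx.1), ← Nat.card_eq_fintype_card]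
    refine Nat.card_congr (Equiv.ofBijective (fun i => ⟨w (i.1 + 1), ?_⟩) ⟨?_, ?_⟩)
    · rcases i with ⟨⟨i, hi⟩, hd⟩
      rcases (Nat.lt_succ_iff.1 hi).eq_or_lt with rfl | hi'
      · exact Or.inl h1
      · exact Or.inr ⟨himg ▸ ⟨i + 1, ⟨by omega, hi'⟩, rfl⟩, hd⟩
    · rintro ⟨i, hi⟩ ⟨j, hj⟩ hij
      have := hw.injective (Subtype.ext_iff.1 hij)
      exact Subtype.ext (Fin.ext (Nat.succ_injective this))
    · rintro ⟨x, rfl | hx⟩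
      · exact ⟨⟨⟨n, by omega⟩, by rw [h1]; exact ⟨1, 0, by simp⟩⟩, Subtype.ext h1⟩
      · obtain ⟨i, ⟨hi1, hi2⟩, hi⟩ := himg.symm ▸ hx.1
        obtain ⟨i, rfl⟩ := Nat.exists_eq_succ_of_ne_zero (by omega : i ≠ 0)
        exact ⟨⟨⟨i, by omega⟩, by rw [← hi] at hx; exact hx.2⟩, Subtype.ext hi⟩
  have hrr : ∀ {V : Set ℝ}, V = U → (∃ _ : Group.FG (lineStabilizer V),
      Group.rank (lineStabilizer V) = 2 * (dyadicPart U).ncard +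
        (nonDyadicRationalPart U).ncard + 2) → ∃ _ : Group.FG (lineStabilizer U),
      Group.rank (lineStabilizer U) = 2 * (dyadicPart U).ncard +
        (nonDyadicRationalPart U).ncard + 2 := fun h h' => h ▸ h'
  refine hrr himg ⟨hfg, ?_⟩
  rw [hr, hcard]
  omega

/-! ### Failure of finite generation at an irrational point. -/

theorem exists_bump {p q : ℝ} (hp : IsDyadicReal p) (hq : IsDyadicReal q) (h : p < q) :
    ∃ f ∈ dyadicPL, (∀ x, x ≤ p ∨ q ≤ x → f x = x) ∧ ∃ x, p < x ∧ f x ≠ x := by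
  obtain ⟨r, hr, hpr, hrq⟩ := IsDyadicReal.exists_between h
  obtain ⟨s, hs, hps, hsr⟩ := IsDyadicReal.exists_between hpr
  -- With `p < s < r < q`, the bump sends `[p, r]` to `[p, s]` and `[r, q]` to `[s, q]`, so it moves
  -- `r` to `s`.
  obtain ⟨f, hf, hfp, hfr⟩ := exists_map_pair hp hr hpr hp hs hps
  obtain ⟨g, hg, hgr, hgq⟩ := exists_map_pair hr hq hrq hs hq (hsr.trans hrq)
  have e1 : g q = (1 : ℝ ≃o ℝ) q := hgq
  have e2 : f r = glue g 1 q e1 r := by rw [glue_of_le _ hrq.le, hfr, hgr]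
  have e3 : (1 : ℝ ≃o ℝ) p = glue f (glue g 1 q e1) r e2 p := by
    rw [glue_of_le _ hpr.le, hfp]; rfl
  refine ⟨glue 1 (glue f (glue g 1 q e1) r e2) p e3, glue_mem (one_mem _)
    (glue_mem hf (glue_mem hg (one_mem _) _ hq) _ hr) _ hp, ?_, r, hpr, ?_⟩
  · rintro x (hx | hx)
    · rw [glue_of_le _ hx]; rfl
    · rw [glue_of_ge _ (h.le.trans hx), glue_of_ge _ (hrq.le.trans hx), glue_of_ge _ hx]; rfl
  · rw [glue_of_ge _ hpr.le, glue_of_le _ le_rfl, hfr]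
    exact hsr.ne

/-- The fixed point of an affine map with slope `2 ^ k ≠ 1` and dyadic constant term `d` is the
rational number `d / (1 - 2 ^ k)`. -/
theorem eventually_eq_self_of_irrational {U : Set ℝ} {u : ℝ} (hu : u ∈ U)
    (hirr : u ∉ Set.range ((↑) : ℚ → ℝ)) {f : ℝ ≃o ℝ} (hf : f ∈ lineStabilizer U) :
    ∀ᶠ y in 𝓝[≥] u, f y = y := by
  obtain ⟨-, -, k, d, -, h, -⟩ := hf.1 u
  have hd := h.apply_Ici
  rw [hf.2 u (Or.inr hu)] at hd
  have hk : k = 0 := by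
    by_contra hk
    have hne : (1 : ℝ) - 2 ^ k ≠ 0 := by
      rw [sub_ne_zero]
      intro h'
      exact hk (zpow_right_injective₀ (two_pos (α := ℝ)) (by norm_num) (by simpa using h'.symm))
    obtain ⟨⟨m, n, rfl⟩, -⟩ := h
    refine hirr ⟨(m / 2 ^ n) / (1 - 2 ^ k), ?_⟩
    push_cast
    rw [div_eq_iff hne]
    linarith
  subst hk
  have hd0 : d = 0 := by
    rw [zpow_zero, one_mul] at hd
    linarith
  filter_upwards [h.2] with y hy
  rw [hy, hd0]; simp

/-- Each of finitely many generators is the identity just to the right of `u`, so all of them, and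
hence the whole group, fix a common interval `(u, b)` pointwise. A bump supported in `(u, b)`,
chosen to avoid `U`, belongs to the group and does not. -/
theorem not_fg_of_irrational {U : Set ℝ} (hfin : U.Finite) (hU : U ⊆ Set.Ioo (0 : ℝ) 1) {u : ℝ}
    (hu : u ∈ U) (hirr : u ∉ Set.range ((↑) : ℚ → ℝ)) : ¬ Group.FG (lineStabilizer U) := by
  rw [Group.fg_iff_subgroup_fg]
  rintro ⟨S, hS⟩
  have hev : ∀ᶠ y in 𝓝[>] u, ∀ f ∈ S, f y = y := by
    refine (Filter.eventually_all_finset S).2 fun f hf => ?_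
    exact nhdsWithin_mono _ Set.Ioi_subset_Ici_self
      (eventually_eq_self_of_irrational hu hirr (hS ▸ Subgroup.subset_closure hf))
  have hev2 : ∀ᶠ y in 𝓝[>] u, y ∉ U := by
    have : ∀ᶠ y in 𝓝 u, y ∉ U \ {u} :=
      (hfin.subset Set.sdiff_subset).isClosed.isOpen_compl.mem_nhds (by simp)
    filter_upwards [nhdsWithin_le_nhds this, self_mem_nhdsWithin] with y hy hy' h
    exact hy ⟨h, ne_of_gt hy'⟩
  obtain ⟨b, hb, hsub⟩ := (mem_nhdsGT_iff_exists_mem_Ioc_Ioo_subset (hU hu).2).1 (hev.and hev2)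
  obtain ⟨p, hp, hup, hpb⟩ := IsDyadicReal.exists_between hb.1
  obtain ⟨q, hq, hpq, hqb⟩ := IsDyadicReal.exists_between hpb
  obtain ⟨f, hf, hfix, x, hpx, hx⟩ := exists_bump hp hq hpq
  have hsub' : ∀ y, ¬ (y ≤ p ∨ q ≤ y) → y ∈ Set.Ioo u b := fun y hy => by
    push Not at hy
    exact ⟨hup.trans hy.1, hy.2.trans hqb⟩
  have hfU : f ∈ lineStabilizer U := by
    refine ⟨hf, fun y hy => ?_⟩
    by_contra hne
    have hmem := hsub' y fun h => hne (hfix y h)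
    rcases hy with hy | hy
    · exact hy ⟨(hU hu).1.trans hmem.1, hmem.2.trans_le hb.2⟩
    · exact (hsub hmem).2 hy
  have hxmem := hsub' x fun h => hx (hfix x h)
  have hle : lineStabilizer U ≤ MulAction.stabilizer (ℝ ≃o ℝ) x := by
    rw [← hS, Subgroup.closure_le]
    exact fun g hg => MulAction.mem_stabilizer_iff.2 ((hsub hxmem).1 g hg)
  exact hx (MulAction.mem_stabilizer_iff.1 (hle hfU))

/-! ### Passage between homeomorphisms of the unit interval and of the line. -/

/-- The restriction to `[0, 1]` of a homeomorphism of the line fixing `0` and `1`. -/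
noncomputable def restrictUnit (f : ℝ ≃o ℝ) (h0 : f 0 = 0) (h1 : f 1 = 1) : I ≃o I where
  toFun x := ⟨f x, by
    have a := f.monotone x.2.1
    have b := f.monotone x.2.2
    rw [h0] at a; rw [h1] at b
    exact ⟨a, b⟩⟩
  invFun x := ⟨f.symm x, by
    rw [Set.mem_Icc, ← f.le_iff_le, ← f.le_iff_le (y := 1), f.apply_symm_apply, h0, h1]
    exact x.2⟩
  left_inv x := Subtype.ext (f.symm_apply_apply _)
  right_inv x := Subtype.ext (f.apply_symm_apply _)
  map_rel_iff' := f.le_iff_le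

theorem isThompson_restrictUnit {f : ℝ ≃o ℝ} (hf : f ∈ dyadicPL) (h0 : f 0 = 0) (h1 : f 1 = 1) :
    IsThompson (restrictUnit f h0 h1) := by
  classical
  obtain ⟨n, hn⟩ := exists_standard_scale hf (isCompact_Icc (a := (0 : ℝ)) (b := 1))
  have hpos : (0 : ℝ) < 2 ^ n := by positivity
  -- The whole grid of mesh `2 ^ (-n)` serves as the set of break points; `Set.projIcc` only places
  -- its points in `I`.
  refine ⟨(Finset.range (2 ^ n + 1)).image fun j : ℕ => Set.projIcc 0 1 zero_le_one (j / 2 ^ n : ℝ),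
    fun b hb => ?_, fun a b hab hB => ?_⟩
  · obtain ⟨j, hj, rfl⟩ := Finset.mem_image.1 hb
    have hj' : (j : ℝ) ≤ 2 ^ n := by exact_mod_cast Nat.lt_succ_iff.1 (Finset.mem_range.1 hj)
    rw [Set.projIcc_of_mem _ ⟨by positivity, (div_le_one hpos).2 hj'⟩]
    exact ⟨j, n, by simp⟩
  · have hab' : (a : ℝ) < b := hab
    -- As `(a, b)` contains no grid point, `[a, b]` lies in the grid cell with index `j`.
    set j := ⌊(a : ℝ) * 2 ^ n⌋ with hjdef
    have hj0 : 0 ≤ j := Int.floor_nonneg.2 (mul_nonneg a.2.1 hpos.le)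
    have ha1 : (j : ℝ) ≤ a * 2 ^ n := Int.floor_le _
    have ha2 : (a : ℝ) * 2 ^ n < j + 1 := Int.lt_floor_add_one _
    have hb2 : (b : ℝ) * 2 ^ n ≤ j + 1 := by
      by_contra! hlt
      have hb1 : (b : ℝ) * 2 ^ n ≤ 2 ^ n := mul_le_of_le_one_left hpos.le b.2.2
      have hjn : (j + 1 : ℤ) < 2 ^ n := by
        have : (j : ℝ) + 1 < 2 ^ n := hlt.trans_le hb1
        exact_mod_cast this
      have hmem : ((j + 1 : ℝ) / 2 ^ n) ∈ Set.Icc (0 : ℝ) 1 := by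
        have hj0' : (0 : ℝ) ≤ j := by exact_mod_cast hj0
        exact ⟨by positivity, (div_le_one hpos).2 (hlt.trans_le hb1).le⟩
      refine hB ⟨_, hmem⟩ (Finset.mem_image.2 ⟨(j + 1).toNat, Finset.mem_range.2 ?_, ?_⟩) ⟨?_, ?_⟩
      · have : ((j + 1).toNat : ℤ) < 2 ^ n := by rwa [Int.toNat_of_nonneg (by omega)]
        have : (j + 1).toNat < 2 ^ n := by exact_mod_cast this
        omega
      · have : (((j + 1).toNat : ℕ) : ℝ) = j + 1 := by
          have := Int.toNat_of_nonneg (by omega : 0 ≤ j + 1)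
          exact_mod_cast congrArg (Int.cast : ℤ → ℝ) this
        rw [this, Set.projIcc_of_mem _ hmem]
      · change (a : ℝ) < (j + 1) / 2 ^ n
        rwa [lt_div_iff₀ hpos]
      · change ((j : ℝ) + 1) / 2 ^ n < b
        rwa [div_lt_iff₀ hpos]
    obtain ⟨l, m, hlm⟩ := hn n le_rfl j ⟨a, a.2, ha1, ha2.le⟩
    refine ⟨n - l, (m - j) / 2 ^ l, fun x hx => ?_⟩
    have hx1 : (a : ℝ) * 2 ^ n ≤ x * 2 ^ n := mul_le_mul_of_nonneg_right hx.1 hpos.le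
    have hx2 : (x : ℝ) * 2 ^ n ≤ b * 2 ^ n := mul_le_mul_of_nonneg_right hx.2 hpos.le
    have := hlm (x * 2 ^ n - j) ⟨by linarith, by linarith⟩
    rw [add_sub_cancel, mul_div_cancel_right₀ _ hpos.ne'] at this
    change f x = _
    rw [this, zpow_sub₀ two_ne_zero, zpow_natCast, zpow_natCast]
    field_simp
    ring

section Extend

open Classical in
/-- The extension by the identity of a self-map of `[0, 1]`. -/
noncomputable def extendFun (f : I ≃o I) (x : ℝ) : ℝ := if h : x ∈ I then f ⟨x, h⟩ else x

theorem extendFun_of_mem (f : I ≃o I) {x : ℝ} (h : x ∈ I) : extendFun f x = f ⟨x, h⟩ := dif_pos h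

theorem extendFun_of_notMem (f : I ≃o I) {x : ℝ} (h : x ∉ I) : extendFun f x = x := dif_neg h

theorem extendFun_inv (f : I ≃o I) (x : ℝ) : extendFun f.symm (extendFun f x) = x := by
  by_cases h : x ∈ I
  · rw [extendFun_of_mem f h, extendFun_of_mem _ (f ⟨x, h⟩).2]
    simp
  · rw [extendFun_of_notMem f h, extendFun_of_notMem _ h]

theorem extendFun_of_notMem_Ioo (f : I ≃o I) {x : ℝ} (h : x ∉ Set.Ioo (0 : ℝ) 1) :
    extendFun f x = x := by
  by_cases hx : x ∈ I
  · rw [extendFun_of_mem f hx]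
    rcases hx.1.eq_or_lt with rfl | h0
    · exact congrArg Subtype.val f.map_bot
    · rcases hx.2.eq_or_lt with rfl | h1
      · exact congrArg Subtype.val f.map_top
      · exact absurd ⟨h0, h1⟩ h
  · exact extendFun_of_notMem f hx

theorem extendFun_mono (f : I ≃o I) : Monotone (extendFun f) := by
  intro x y hxy
  by_cases hx : x ∈ I
  · by_cases hy : y ∈ I
    · rw [extendFun_of_mem f hx, extendFun_of_mem f hy]
      exact f.monotone hxy
    · rw [extendFun_of_mem f hx, extendFun_of_notMem f hy]
      by_contra hlt
      exact hy ⟨hx.1.trans hxy, (not_le.1 hlt).le.trans (f _).2.2⟩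
  · by_cases hy : y ∈ I
    · rw [extendFun_of_notMem f hx, extendFun_of_mem f hy]
      by_contra hlt
      exact hx ⟨(f _).2.1.trans (not_le.1 hlt).le, hxy.trans hy.2⟩
    · rwa [extendFun_of_notMem f hx, extendFun_of_notMem f hy]

/-- The extension by the identity of a self-homeomorphism of `[0, 1]`. -/
noncomputable def extend (f : I ≃o I) : ℝ ≃o ℝ where
  toFun := extendFun f
  invFun := extendFun f.symm
  left_inv := extendFun_inv f
  right_inv := extendFun_inv f.symm
  map_rel_iff' := fun {x y} => by
    refine ⟨fun h => ?_, fun h => extendFun_mono f h⟩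
    rw [← extendFun_inv f x, ← extendFun_inv f y]
    exact extendFun_mono f.symm h

/-- `IsThompson` does not ask for dyadic constant terms. They are dyadic because `f` sends a dyadic
point of the interval to a dyadic point. -/
theorem isAffGerm_extendFun {f : I ≃o I} (hf : IsThompson f) {k : ℤ} {c : ℝ} {a b : ℝ}
    (ha : 0 ≤ a) (hb : b ≤ 1) (hab : a < b)
    (h : ∀ x : I, a ≤ x → x ≤ b → ((f x : I) : ℝ) = 2 ^ k * (x : ℝ) + c) :
    IsDyadicReal c ∧ ∀ x ∈ Set.Icc a b, extendFun f x = 2 ^ k * x + c := by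
  have hI : ∀ x ∈ Set.Icc a b, x ∈ I := fun x hx => ⟨ha.trans hx.1, hx.2.trans hb⟩
  obtain ⟨d, hd, had, hdb⟩ := IsDyadicReal.exists_between hab
  refine ⟨?_, fun x hx => ?_⟩
  · have hdI := hI d ⟨had.le, hdb.le⟩
    have h1 := hf.dyadic_apply ⟨d, hdI⟩ hd
    rw [h ⟨d, hdI⟩ had.le hdb.le] at h1
    have := h1.sub (hd.zpow_mul k)
    simpa using this
  · rw [extendFun_of_mem f (hI x hx)]
    exact h _ hx.1 hx.2

/-- Near a point of `(0, 1)` only that point can be a break, and then it is dyadic. At `0` and `1`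
the identity is attached, which may create a break, but these points are dyadic. -/
theorem extend_mem {f : I ≃o I} (hf : IsThompson f) : extend f ∈ dyadicPL := by
  obtain ⟨B, hB, haff⟩ := id hf
  have hIoo : ∀ x ∈ Set.Ioo (0 : ℝ) 1, DyadicPLAt (extendFun f) x := by
    intro x hx
    have hfin : ((↑) '' (B : Set I) : Set ℝ).Finite := B.finite_toSet.image _
    have hev : ∀ᶠ y in 𝓝 x, y ∉ ((↑) '' (B : Set I) : Set ℝ) \ {x} :=
      (hfin.subset Set.sdiff_subset).isClosed.isOpen_compl.mem_nhds (by simp)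
    obtain ⟨a, b, ⟨hax, hxb⟩, hsub⟩ := mem_nhds_iff_exists_Ioo_subset.1
      (hev.and (Ioo_mem_nhds hx.1 hx.2))
    obtain ⟨p, hap, hpx⟩ := exists_between hax
    obtain ⟨q, hxq, hqb⟩ := exists_between hxb
    have hmem : ∀ y ∈ Set.Icc p q, y ∈ Set.Ioo a b := fun y hy =>
      ⟨hap.trans_le hy.1, hy.2.trans_lt hqb⟩
    have hI : ∀ y ∈ Set.Icc p q, y ∈ I := fun y hy =>
      Set.Ioo_subset_Icc_self (hsub (hmem y hy)).2
    have hBx : ∀ y ∈ B, (y : ℝ) ∈ Set.Icc p q → (y : ℝ) = x := fun y hy hy' => by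
      by_contra hne
      exact (hsub (hmem y hy')).1 ⟨⟨y, hy, rfl⟩, hne⟩
    have hpI := hI p ⟨le_rfl, (hpx.trans hxq).le⟩
    have hqI := hI q ⟨(hpx.trans hxq).le, le_rfl⟩
    have hxI := hI x ⟨hpx.le, hxq.le⟩
    by_cases hdy : IsDyadicReal x
    · obtain ⟨k, d, hk⟩ := haff ⟨p, hpI⟩ ⟨x, hxI⟩ hpx fun y hy hyx =>
        (ne_of_lt hyx.2) (Subtype.ext (hBx y hy ⟨le_of_lt hyx.1, (show (y : ℝ) < x from hyx.2).le.trans hxq.le⟩))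
      obtain ⟨k', d', hk'⟩ := haff ⟨x, hxI⟩ ⟨q, hqI⟩ hxq fun y hy hyx =>
        (ne_of_gt hyx.1) (Subtype.ext (hBx y hy ⟨hpx.le.trans (show x < (y : ℝ) from hyx.1).le, le_of_lt hyx.2⟩))
      obtain ⟨e1, e2⟩ := isAffGerm_extendFun hf hpI.1 hxI.2 hpx fun y h1 h2 => hk y ⟨h1, h2⟩
      obtain ⟨e1', e2'⟩ := isAffGerm_extendFun hf hxI.1 hqI.2 hxq fun y h1 h2 => hk' y ⟨h1, h2⟩
      refine ⟨k, d, k', d', ⟨e1, ?_⟩, ⟨e1', ?_⟩, Or.inl hdy⟩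
      · filter_upwards [Icc_mem_nhdsLE hpx] with y hy using e2 y hy
      · filter_upwards [Icc_mem_nhdsGE hxq] with y hy using e2' y hy
    · obtain ⟨k, d, hk⟩ := haff ⟨p, hpI⟩ ⟨q, hqI⟩ (hpx.trans hxq) fun y hy hyx =>
        hdy (hBx y hy ⟨le_of_lt hyx.1, le_of_lt hyx.2⟩ ▸ hB y hy)
      obtain ⟨e1, e2⟩ := isAffGerm_extendFun hf hpI.1 hqI.2 (hpx.trans hxq)
        fun y h1 h2 => hk y ⟨h1, h2⟩
      refine (DyadicPLAt.affine k e1 x).congr ?_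
      filter_upwards [Icc_mem_nhds hpx hxq] with y hy using e2 y hy
  have hid : ∀ x, x < 0 ∨ 1 < x → DyadicPLAt (extendFun f) x := by
    intro x hx
    refine (DyadicPLAt.id x).congr ?_
    rcases hx with hx | hx
    · filter_upwards [isOpen_Iio.mem_nhds hx] with y hy
      exact extendFun_of_notMem_Ioo f fun h => lt_asymm hy h.1
    · filter_upwards [isOpen_Ioi.mem_nhds hx] with y hy
      exact extendFun_of_notMem_Ioo f fun h => lt_asymm hy h.2
  have hzero : DyadicPLAt (extendFun f) 0 := by
    have hfin : ((↑) '' (B : Set I) : Set ℝ).Finite := B.finite_toSet.image _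
    have hev : ∀ᶠ y in 𝓝 (0 : ℝ), y ∉ ((↑) '' (B : Set I) : Set ℝ) \ {0} :=
      (hfin.subset Set.sdiff_subset).isClosed.isOpen_compl.mem_nhds (by simp)
    obtain ⟨a, b, ⟨ha, hb⟩, hsub⟩ := mem_nhds_iff_exists_Ioo_subset.1
      (hev.and (isOpen_Iio.mem_nhds (zero_lt_one (α := ℝ))))
    obtain ⟨q, hq0, hqb⟩ := exists_between hb
    have hqI : q ∈ I := ⟨hq0.le, le_of_lt (hsub ⟨ha.trans hq0, hqb⟩).2⟩
    obtain ⟨k, d, hk⟩ := haff 0 ⟨q, hqI⟩ hq0 fun y hy hyx => by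
      have h1 : (0 : ℝ) < y := hyx.1
      have h2 : (y : ℝ) < q := hyx.2
      exact (hsub ⟨ha.trans h1, h2.trans hqb⟩).1 ⟨⟨y, hy, rfl⟩, h1.ne'⟩
    obtain ⟨e1, e2⟩ := isAffGerm_extendFun hf le_rfl hqI.2 hq0 fun y h1 h2 => hk y ⟨h1, h2⟩
    refine DyadicPLAt.of_germs (DyadicPLAt.id _) (DyadicPLAt.affine k e1 0) ?_ ?_ (Or.inl .zero)
    · filter_upwards [self_mem_nhdsWithin] with y hy
      exact extendFun_of_notMem_Ioo f fun h => (not_lt.2 hy) h.1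
    · filter_upwards [Icc_mem_nhdsGE hq0] with y hy using e2 y hy
  have hone : DyadicPLAt (extendFun f) 1 := by
    have hfin : ((↑) '' (B : Set I) : Set ℝ).Finite := B.finite_toSet.image _
    have hev : ∀ᶠ y in 𝓝 (1 : ℝ), y ∉ ((↑) '' (B : Set I) : Set ℝ) \ {1} :=
      (hfin.subset Set.sdiff_subset).isClosed.isOpen_compl.mem_nhds (by simp)
    obtain ⟨a, b, ⟨ha, hb⟩, hsub⟩ := mem_nhds_iff_exists_Ioo_subset.1
      (hev.and (isOpen_Ioi.mem_nhds (zero_lt_one (α := ℝ))))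
    obtain ⟨p, hap, hp1⟩ := exists_between ha
    have hpI : p ∈ I := ⟨le_of_lt (hsub ⟨hap, hp1.trans hb⟩).2, hp1.le⟩
    obtain ⟨k, d, hk⟩ := haff ⟨p, hpI⟩ 1 hp1 fun y hy hyx => by
      have h1 : p < (y : ℝ) := hyx.1
      have h2 : (y : ℝ) < 1 := hyx.2
      exact (hsub ⟨hap.trans h1, h2.trans hb⟩).1 ⟨⟨y, hy, rfl⟩, h2.ne⟩
    obtain ⟨e1, e2⟩ := isAffGerm_extendFun hf hpI.1 le_rfl hp1 fun y h1 h2 => hk y ⟨h1, h2⟩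
    refine DyadicPLAt.of_germs (DyadicPLAt.affine k e1 1) (DyadicPLAt.id _) ?_ ?_
      (Or.inl ⟨1, 0, by simp⟩)
    · filter_upwards [Icc_mem_nhdsLE hp1] with y hy using e2 y hy
    · filter_upwards [self_mem_nhdsWithin] with y hy
      exact extendFun_of_notMem_Ioo f fun h => (not_lt.2 hy) h.2
  intro x
  rcases lt_trichotomy x 0 with h | rfl | h
  · exact hid x (Or.inl h)
  · exact hzero
  · rcases lt_trichotomy x 1 with h' | rfl | h'
    · exact hIoo x ⟨h, h'⟩
    · exact hone
    · exact hid x (Or.inr h')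

end Extend

theorem lineStabilizer_zero {U : Set ℝ} (f : lineStabilizer U) : f.1 0 = 0 :=
  f.2.2 0 (Or.inl (by simp))

theorem lineStabilizer_one {U : Set ℝ} (f : lineStabilizer U) : f.1 1 = 1 :=
  f.2.2 1 (Or.inl (by simp))

/-- Restriction to `[0, 1]`. -/
noncomputable def restrictHom (U : Set ℝ) : lineStabilizer U →* thompsonStabilizer U :=
  MonoidHom.mk' (fun f => ⟨⟨restrictUnit f.1 (lineStabilizer_zero f) (lineStabilizer_one f),
    isThompson_restrictUnit f.2.1 _ _⟩, fun x hx => Subtype.ext (f.2.2 x (Or.inr hx))⟩)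
    fun _ _ => rfl

theorem restrictHom_bijective (U : Set ℝ) : Function.Bijective (restrictHom U) := by
  constructor
  · intro f g hfg
    refine Subtype.ext (OrderIso.ext (funext fun x => ?_))
    by_cases hx : x ∈ Set.Ioo (0 : ℝ) 1
    · have h1 : ((restrictHom U f : thompsonF) : I ≃o I) ⟨x, Set.Ioo_subset_Icc_self hx⟩ =
          ((restrictHom U g : thompsonF) : I ≃o I) ⟨x, Set.Ioo_subset_Icc_self hx⟩ := by rw [hfg]
      exact congrArg Subtype.val h1
    · rw [f.2.2 x (Or.inl hx), g.2.2 x (Or.inl hx)]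
  · rintro ⟨⟨f, hf⟩, hfU⟩
    refine ⟨⟨extend f, extend_mem hf, fun x hx => ?_⟩, ?_⟩
    · by_cases hxI : x ∈ Set.Ioo (0 : ℝ) 1
      · have hxU := hx.resolve_left (not_not.2 hxI)
        exact (extendFun_of_mem f (Set.Ioo_subset_Icc_self hxI)).trans
          (congrArg Subtype.val (hfU ⟨x, Set.Ioo_subset_Icc_self hxI⟩ hxU))
      · exact extendFun_of_notMem_Ioo f hxI
    · refine Subtype.ext (Subtype.ext (OrderIso.ext (funext fun x => Subtype.ext ?_)))
      exact extendFun_of_mem f x.2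

/-- The stabilizers in Thompson's group, in terms of homeomorphisms of the line. -/
noncomputable def stabilizerEquiv (U : Set ℝ) : lineStabilizer U ≃* thompsonStabilizer U :=
  MulEquiv.ofBijective (restrictHom U) (restrictHom_bijective U)

end DyadicPL

open DyadicPL in
theorem theoremt (U : Set ℝ) (hfin : U.Finite) (hU : U ⊆ Set.Ioo (0 : ℝ) 1) :
    (Group.FG (thompsonStabilizer U) ↔ U ⊆ Set.range ((↑) : ℚ → ℝ)) ∧
    (U ⊆ Set.range ((↑) : ℚ → ℝ) →
      ∃ _ : Group.FG (thompsonStabilizer U),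
        Group.rank (thompsonStabilizer U) =
          2 * (dyadicPart U).ncard + (nonDyadicRationalPart U).ncard + 2) := by
  have e := stabilizerEquiv U
  have hrank : U ⊆ Set.range ((↑) : ℚ → ℝ) → ∃ _ : Group.FG (thompsonStabilizer U),
      Group.rank (thompsonStabilizer U) =
        2 * (dyadicPart U).ncard + (nonDyadicRationalPart U).ncard + 2 := by
    intro hrat
    obtain ⟨hfg, hr⟩ := lineStabilizer_rank_of_rational hfin hU hrat
    have hfg' : Group.FG (thompsonStabilizer U) :=
      Group.fg_of_surjective (f := e.toMonoidHom) e.surjective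
    exact ⟨hfg', by rw [← Group.rank_congr e, hr]⟩
  refine ⟨⟨fun hfg u hu => ?_, fun h => (hrank h).1⟩, hrank⟩
  by_contra hirr
  exact not_fg_of_irrational hfin hU hu hirr
    (Group.fg_of_surjective (f := e.symm.toMonoidHom) e.symm.surjective)
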